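/- **Notation.** Let $X=\{x_0,x_1\}$, let $X^*$ be the set of words over $X$ ($\emptyset$ is the empty word, $|\eta|$ the length of $\eta$), and let $\mathbb R\langle\langle X\rangle\rangle$ be the set of all maps $c:X^*\to\mathbb R$, $\eta\mapsto(c,\eta)$, written $c=\sum_\eta (c,\eta)\eta$. The shuffle product $\mathbin{\sqcup\!\sqcup}$ is the bilinear extension of $\eta \mathbin{\sqcup\!\sqcup}\emptyset=\emptyset \mathbin{\sqcup\!\sqcup}\eta=\eta$, $(x_i\eta)\mathbin{\sqcup\!\sqcup}(x_j\xi)=x_i(\eta \mathbin{\sqcup\!\sqcup}(x_j\xi))+x_j((x_i\eta)\mathbin{\sqcup\!\sqcup}\xi)$. For a pair $d_\delta=(d_L,d_R)$ of series put $\phi_d(x_0)(e)=x_0e$, $\phi_d(x_1)(e)=x_1(d_L\mathbin{\sqcup\!\sqcup}e)+x_0(d_R\mathbin{\sqcup\!\sqcup}e)$, $\phi_d(\emptyset)=\mathrm{id}$, $\phi_d(x_i\eta)=\phi_d(x_i)\circ\phi_d(\eta)$. The mixed composition product is $c\,\tilde\circ\, d_\delta=\sum_\eta (c,\eta)\,\phi_d(\eta)(1)$,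 and the composition product of pairs is $$c_\delta\circ d_\delta=\big((c_L\tilde\circ d_\delta)\mathbin{\sqcup\!\sqcup}d_L,\ (c_L\tilde\circ d_\delta)\mathbin{\sqcup\!\sqcup}d_R+c_R\tilde\circ d_\delta\big).$$ The iterated integrals of an input $u$ are $E_\emptyset[u]=1$ and $E_{x_i\eta}[u](t)=\int_{t_0}^t u_i(\tau)E_\eta[u](\tau)\,d\tau$, where $u_0=1$, $u_1=u$. The Fliess operator of $c$ is $F_c[u]=\sum_{\eta}(c,\eta)E_\eta[u]$, and the affine operator of a pair is $F_{d_\delta}[u]=u\,F_{d_L}[u]+F_{d_R}[u]$. **Theorem.** For all $c\in\mathbb R\langle\langle X\rangle\rangle$ and all pairs $c_\delta=(c_L,c_R)$, $d_\delta=(d_L,d_R)$ of series, $$\text{(1)}\quad F_c\circ F_{d_\delta}=F_{c\,\tilde\circ\, d_\delta},\qquad\qquad \text{(2)}\quad F_{c_\delta}\circ F_{d_\delta}=F_{c_\delta\circ d_\delta},$$ in each of the following senses. (a) *Formal operators, arbitrary series.* (1) and (2) hold as identities of maps $\mathbb R[[t-t_0]]\to\mathbb R[[t-t_0]]$, where the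 input $u$ is a formal power series in $t-t_0$, the integrals are taken termwise, and the sum over $\eta$ converges coefficientwise (as $E_\eta[u]$ is divisible by $(t-t_0)^{|\eta|}$). (b) *Integrable inputs, arbitrary series.* Let $t_0\le t_1$ and $u\in L_1[t_0,t_1]$. Call $F_c[u](t)$ absolutely convergent if $\sum_\eta|(c,\eta)|\,E_\eta[|u|](t)<\infty$. Say that the cascade of $F_c$ after $F_{d_\delta}$ converges absolutely at $u$ if $F_{d_L}[u](t_1)$ and $F_{d_R}[u](t_1)$ are absolutely convergent and $\sum_\eta|(c,\eta)|\,E_\eta[V](t_1)<\infty$, where $V=|u|\,F_{|d_L|}[|u|]+F_{|d_R|}[|u|]$ and $|d|=\sum_\eta|(d,\eta)|\eta$. If this is so, then $F_{d_\delta}[u]\in L_1[t_0,t_1]$, and for every $t\in[t_0,t_1]$ both $F_c[F_{d_\delta}[u]](t)$ and $F_{c\tilde\circ d_\delta}[u](t)$ are absolutely convergent and equal. If this is so for both $c=c_L$ and $c=c_R$, then $F_{d_\delta}[u]\in L_1[t_0,t_1]$, and for every $t\in[t_0,t_1]$ all the series entering $F_{c_\delta}[F_{d_\delta}[u]](t)$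 and $F_{c_\delta\circ d_\delta}[u](t)$ (those of $F_{c_L},F_{c_R}$ at $F_{d_\delta}[u]$ and of $F_{(c_\delta\circ d_\delta)_L},F_{(c_\delta\circ d_\delta)_R}$ at $u$) are absolutely convergent, and $F_{c_\delta}[F_{d_\delta}[u]](t)=F_{c_\delta\circ d_\delta}[u](t)$. (c) *Locally convergent series.* Call $c$ locally convergent if $|(c,\eta)|\le K M^{|\eta|}|\eta|!$ for all $\eta$ and some $K,M>0$. If $c,d_L,d_R$ are locally convergent, there are $R,T>0$ such that for every $t_0$ and every $u\in L_1[t_0,t_0+T]$ with $\|u\|_1\le R$ the cascade of $F_c$ after $F_{d_\delta}$ converges absolutely at $u$ on $[t_0,t_0+T]$, and $F_c[F_{d_\delta}[u]](t)=F_{c\tilde\circ d_\delta}[u](t)$ for all $t\in[t_0,t_0+T]$. If $c_L,c_R,d_L,d_R$ are locally convergent, there are $R,T>0$ such that for all such $t_0,u$ the cascades of $F_{c_L}$ and of $F_{c_R}$ after $F_{d_\delta}$ converge absolutely at $u$ on $[t_0,t_0+T]$, and $F_{c_\delta}[F_{d_\delta}[u]](t)=F_{c_\delta\circ d_\delta}[u](t)$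 for all $t\in[t_0,t_0+T]$. -/

import Mathlib

open MeasureTheory

noncomputable section

namespace Fliess

/-! ### Words and formal power series over the alphabet with letters `x_0, x_1` -/

/-- Words over the two-letter alphabet; the letter `x_i` is `i : Fin 2`. -/
abbrev Word := List (Fin 2)

/-- A formal power series: the coefficient of the word `η` in `c` is `c η`.
Only the additive structure of the function space is used. -/
abbrev Series := Word → ℝ

/-- Pairs `d_δ = (d_L, d_R)` of series: `d.1` is the left one, `d.2` the right one. -/
abbrev SeriesPair := Series × Series

/-- The finite set of words with exactly `n` letters. -/
def wordsOfLength (n : ℕ) : Finset Word :=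
  (Finset.univ : Finset (Fin n → Fin 2)).image List.ofFn

theorem mem_wordsOfLength {n : ℕ} {η : Word} : η ∈ wordsOfLength n ↔ η.length = n := by
  unfold wordsOfLength
  constructor
  · intro h
    obtain ⟨f, -, rfl⟩ := Finset.mem_image.1 h
    simp
  · rintro rfl
    exact Finset.mem_image.2 ⟨η.get, Finset.mem_univ _, List.ofFn_get η⟩

/-- The series with the single term `η`. -/
def wordSeries (η : Word) : Series := fun ν => if ν = η then 1 else 0

/-- Left catenation `x_i e` of a series `e` by a letter. -/
def letterMul (i : Fin 2) (e : Series) : Series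
  | [] => 0
  | j :: ν => if j = i then e ν else 0

/-- The shuffle product of two words. -/
def wordShuffle : Word → Word → Series
  | [], ξ => wordSeries ξ
  | i :: η, [] => wordSeries (i :: η)
  | i :: η, j :: ξ =>
      letterMul i (wordShuffle η (j :: ξ)) + letterMul j (wordShuffle (i :: η) ξ)
  termination_by η ξ => η.length + ξ.length

/-- Only words of length `|η| + |ξ|` occur in the shuffle of `η` and `ξ`. -/
theorem wordShuffle_eq_zero (η ξ ν : Word) (h : η.length + ξ.length ≠ ν.length) :
    wordShuffle η ξ ν = 0 := by
  induction ν generalizing η ξ with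
  | nil =>
    cases η with
    | nil =>
      cases ξ with
      | nil => simp at h
      | cons j ξ => simp [wordShuffle, wordSeries]
    | cons i η =>
      cases ξ with
      | nil => simp [wordShuffle, wordSeries]
      | cons j ξ => simp [wordShuffle, letterMul]
  | cons k ν ih =>
    cases η with
    | nil =>
      have hne : k :: ν ≠ ξ := by rintro rfl; simp at h
      simp [wordShuffle, wordSeries, hne]
    | cons i η =>
      cases ξ with
      | nil =>
        have hne : k :: ν ≠ i :: η := by
          intro e
          rw [e] at h
          simp at h
        simp only [wordShuffle, wordSeries, if_neg hne]
      | cons j ξ =>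
        have h1 : wordShuffle η (j :: ξ) ν = 0 := by
          apply ih
          simp only [List.length_cons] at h ⊢
          omega
        have h2 : wordShuffle (i :: η) ξ ν = 0 := by
          apply ih
          simp only [List.length_cons] at h ⊢
          omega
        simp [wordShuffle, letterMul, h1, h2]

/-- The shuffle product of series, the bilinear extension of `wordShuffle`:
the coefficient of `ν` is the sum of `(c, η) (d, ξ) (η ⧢ ξ, ν)` over all `η`, `ξ`. By
`wordShuffle_eq_zero` only the finitely many pairs with `|η| + |ξ| = |ν|` contribute. -/
def shuffle (c d : Series) : Series := fun ν =>
  ∑ p ∈ Finset.HasAntidiagonal.antidiagonal ν.length, ∑ η ∈ wordsOfLength p.1, ∑ ξ ∈ wordsOfLength p.2,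
    c η * d ξ * wordShuffle η ξ ν

/-! ### The mixed composition product and the composition product of pairs -/

/-- `φ_d(x_0)(e) = x_0 e` and `φ_d(x_1)(e) = x_1 (d_L ⧢ e) + x_0 (d_R ⧢ e)`. -/
def phiLetter (d : SeriesPair) : Fin 2 → Series → Series
  | 0, e => letterMul 0 e
  | 1, e => letterMul 1 (shuffle d.1 e) + letterMul 0 (shuffle d.2 e)

/-- `φ_d` on words: `φ_d(∅) = id` and `φ_d(x_i η) = φ_d(x_i) ∘ φ_d(η)`. -/
def phiWord (d : SeriesPair) : Word → Series → Series
  | [] => id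
  | i :: η => phiLetter d i ∘ phiWord d η

theorem shuffle_eq_zero (c e : Series) (n : ℕ) (he : ∀ ν : Word, ν.length < n → e ν = 0)
    (ν : Word) (hν : ν.length < n) : shuffle c e ν = 0 := by
  unfold shuffle
  refine Finset.sum_eq_zero fun p hp => Finset.sum_eq_zero fun η _ =>
    Finset.sum_eq_zero fun ξ hξ => ?_
  have h1 := Finset.HasAntidiagonal.mem_antidiagonal.1 hp
  have h2 := mem_wordsOfLength.1 hξ
  rw [he ξ (by omega)]
  simp

/-- The series `φ_d(η)(1)` has no terms of length less than `|η|`. -/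
theorem phiWord_eq_zero (d : SeriesPair) (η ν : Word) (h : ν.length < η.length) :
    phiWord d η (wordSeries []) ν = 0 := by
  induction η generalizing ν with
  | nil => simp at h
  | cons i η ih =>
    have key : ∀ (j : Fin 2) (e : Series), (∀ μ : Word, μ.length < η.length → e μ = 0) →
        letterMul j e ν = 0 := by
      intro j e he
      cases ν with
      | nil => rfl
      | cons k ν =>
        simp only [List.length_cons] at h
        simp only [letterMul, he ν (by omega), ite_self]
    fin_cases i
    · exact key 0 _ ih
    · change letterMul 1 (shuffle d.1 (phiWord d η (wordSeries []))) ν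
        + letterMul 0 (shuffle d.2 (phiWord d η (wordSeries []))) ν = 0
      rw [key 1 _ (shuffle_eq_zero _ _ _ ih), key 0 _ (shuffle_eq_zero _ _ _ ih), add_zero]

/-- The mixed composition product `c ∘̃ d_δ = ∑_η (c, η) φ_d(η)(1)`. By `phiWord_eq_zero` only
the finitely many words `η` with `|η| ≤ |ν|` contribute to the coefficient of `ν`. -/
def mixedComp (c : Series) (d : SeriesPair) : Series := fun ν =>
  ∑ k ∈ Finset.range (ν.length + 1), ∑ η ∈ wordsOfLength k,
    c η * phiWord d η (wordSeries []) ν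

/-- The composition product of pairs
`c_δ ∘ d_δ = ((c_L ∘̃ d_δ) ⧢ d_L, (c_L ∘̃ d_δ) ⧢ d_R + c_R ∘̃ d_δ)`. -/
def pairComp (c d : SeriesPair) : SeriesPair :=
  (shuffle (mixedComp c.1 d) d.1, shuffle (mixedComp c.1 d) d.2 + mixedComp c.2 d)

/-! ### Fliess operators on integrable inputs -/

/-- The iterated integrals `E_η[u](t, t₀)`, with `u_0 = 1` and `u_1 = u`. -/
def iterInt (t₀ : ℝ) (u : ℝ → ℝ) : Word → ℝ → ℝ
  | [], _ => 1
  | i :: η, t => ∫ τ in t₀..t, (if i = 0 then 1 else u τ) * iterInt t₀ u η τ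

/-- The Fliess operator `F_c[u](t) = ∑_η (c, η) E_η[u](t, t₀)`. -/
def fliess (c : Series) (t₀ : ℝ) (u : ℝ → ℝ) (t : ℝ) : ℝ :=
  ∑' η : Word, c η * iterInt t₀ u η t

/-- The affine operator `F_{d_δ}[u] = u F_{d_L}[u] + F_{d_R}[u]`. -/
def affineFliess (d : SeriesPair) (t₀ : ℝ) (u : ℝ → ℝ) (t : ℝ) : ℝ :=
  u t * fliess d.1 t₀ u t + fliess d.2 t₀ u t

/-- Absolute convergence of the iterated-integral expansion of `F_c[u](t)`:
`∑_η |(c, η)| E_η[|u|](t, t₀) < ∞`. -/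
def AbsConverges (c : Series) (t₀ : ℝ) (u : ℝ → ℝ) (t : ℝ) : Prop :=
  Summable fun η : Word => |c η| * iterInt t₀ (fun τ => |u τ|) η t

/-- The coefficientwise absolute values of a pair of series. -/
def absPair (d : SeriesPair) : SeriesPair := (fun η => |d.1 η|, fun η => |d.2 η|)

/-- Absolute convergence on `[t₀, t₁]` of the expansion of the cascade `F_c[F_{d_δ}[u]]`: the
series of `F_{d_L}[u]` and `F_{d_R}[u]` converge absolutely, and `∑_η |(c, η)| E_η[V] < ∞` where
`V = |u| F_{|d_L|}[|u|] + F_{|d_R|}[|u|]` is the termwise majorant of `F_{d_δ}[u]`.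
(The terms are nondecreasing in time, so convergence at `t₁` is convergence on `[t₀, t₁]`.) -/
def CascadeConverges (c : Series) (d : SeriesPair) (t₀ t₁ : ℝ) (u : ℝ → ℝ) : Prop :=
  AbsConverges d.1 t₀ u t₁ ∧ AbsConverges d.2 t₀ u t₁ ∧
    AbsConverges c t₀ (affineFliess (absPair d) t₀ fun τ => |u τ|) t₁

/-- Local convergence: `|(c, η)| ≤ K M ^ |η| |η|!` for some `K, M > 0`. -/
def LocallyConvergent (c : Series) : Prop :=
  ∃ K M : ℝ, 0 < K ∧ 0 < M ∧ ∀ η : Word, |c η| ≤ K * M ^ η.length * (Nat.factorial η.length : ℝ)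

/-- The ball of radius `R` in `L_1[t₀, t₁]`. -/
def InBall (R t₀ t₁ : ℝ) (u : ℝ → ℝ) : Prop :=
  IntegrableOn u (Set.Icc t₀ t₁) ∧ ∫ τ in Set.Icc t₀ t₁, |u τ| ≤ R

/-! ### Fliess operators on formal inputs

Here inputs and outputs are formal power series in `t - t₀`, so that `F_c` is defined for every
series `c` without any growth condition. -/

/-- Formal integration from `t₀`: `(t - t₀)^n ↦ (t - t₀)^(n+1) / (n+1)`. -/
def formalInt (f : PowerSeries ℝ) : PowerSeries ℝ :=
  PowerSeries.X * PowerSeries.mk fun n => PowerSeries.coeff n f / ((n : ℝ) + 1)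

/-- The formal iterated integrals `E_η[u]`, with `u_0 = 1` and `u_1 = u`. -/
def formalIterInt (u : PowerSeries ℝ) : Word → PowerSeries ℝ
  | [] => 1
  | i :: η => formalInt ((if i = 0 then 1 else u) * formalIterInt u η)

/-- `E_η[u]` is divisible by `(t - t₀)^|η|`. -/
theorem coeff_formalIterInt_eq_zero (u : PowerSeries ℝ) (η : Word) (n : ℕ) (h : n < η.length) :
    PowerSeries.coeff n (formalIterInt u η) = 0 := by
  have key : PowerSeries.X ^ η.length ∣ formalIterInt u η := by
    clear h
    induction η with
    | nil => simp
    | cons i η ih =>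
      rw [List.length_cons, pow_succ']
      refine mul_dvd_mul_left _ (PowerSeries.X_pow_dvd_iff.2 fun m hm => ?_)
      rw [PowerSeries.coeff_mk, PowerSeries.X_pow_dvd_iff.1 (ih.mul_left _) m hm, zero_div]
  exact PowerSeries.X_pow_dvd_iff.1 key n h

/-- The formal Fliess operator `F_c[u] = ∑_η (c, η) E_η[u]`. By `coeff_formalIterInt_eq_zero`
only the finitely many words with `|η| ≤ n` contribute to the coefficient of `(t - t₀)^n`. -/
def formalFliess (c : Series) (u : PowerSeries ℝ) : PowerSeries ℝ :=
  PowerSeries.mk fun n => ∑ k ∈ Finset.range (n + 1), ∑ η ∈ wordsOfLength k,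
    c η * PowerSeries.coeff n (formalIterInt u η)

/-- The formal affine operator `F_{d_δ}[u] = u F_{d_L}[u] + F_{d_R}[u]`. -/
def formalAffineFliess (d : SeriesPair) (u : PowerSeries ℝ) : PowerSeries ℝ :=
  u * formalFliess d.1 u + formalFliess d.2 u

end Fliess

end

namespace Fliess

/-! ### Iterated Rota–Baxter operators and shuffles -/

/-! The core is the identity E_η[F_{d_δ}[u]] = F_{φ_d(η)(1)}[u], proved by induction on η
(`formalIterInt_formalAffineFliess`, `iterInt_affineFliess`). It needs two translation rules: left
catenation by x_i is integration against u_i, and the shuffle product is the pointwise product of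
operators. The latter holds for iterated operators satisfying I_i a · I_j b = I_i(a · I_j b) +
I_j(I_i a · b), which is integration by parts. `iterOp_mul_iterOp` proves it once in this abstract
form; it is then applied in ℝ[[X]] and in C(ℝ, ℝ). Weighting the identity by (c, η), summing over η
and interchanging the sums over η and ν gives (1); applying (1) to c_L and c_R and using the shuffle
rule gives (2).

What differs between the three settings is the interchange. For formal inputs all sums are finite in
each degree. For integrable inputs the double series is dominated by |(c, η)| (φ_{|d|}(η)(1), ν)
E_ν[|u|], because shuffle coefficients are nonnegative. By the core identity for |d| and |u|, row η
of this majorant sums to |(c, η)| E_η[V], which is summable in η by hypothesis. Fubini applies, and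
each column has finitely many nonzero terms.

For locally convergent series, n! ∑_{|η|=n} E_η[|u|](t) = (t - t₀ + ∫|u|)^n cancels the factorial
growth. On a small ball the inner series are bounded by constants, so V is small in L_1, and the
same estimate applies to c at V. -/

theorem sum_wordsOfLength_zero {M : Type*} [AddCommMonoid M] (f : Word → M) :
    ∑ η ∈ wordsOfLength 0, f η = f [] := by
  have h : wordsOfLength 0 = {[]} := by
    ext η
    simp [mem_wordsOfLength]
  rw [h, Finset.sum_singleton]

theorem sum_wordsOfLength_succ {M : Type*} [AddCommMonoid M] (f : Word → M) (n : ℕ) :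
    ∑ η ∈ wordsOfLength (n + 1), f η = ∑ i : Fin 2, ∑ η ∈ wordsOfLength n, f (i :: η) := by
  have h : wordsOfLength (n + 1) =
      (Finset.univ ×ˢ wordsOfLength n).image fun p : Fin 2 × Word => p.1 :: p.2 := by
    ext η
    cases η with
    | nil => simp [mem_wordsOfLength]
    | cons i η => simp [mem_wordsOfLength]
  rw [h, Finset.sum_image, Finset.sum_product]
  rintro ⟨i, η⟩ - ⟨j, ξ⟩ - h
  simpa using h

/-- The words with fewer than `N` letters. -/
def wordsBelow (N : ℕ) : Finset Word := (Finset.range N).biUnion wordsOfLength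

theorem mem_wordsBelow {N : ℕ} {η : Word} : η ∈ wordsBelow N ↔ η.length < N := by
  simp [wordsBelow, mem_wordsOfLength]

theorem sum_wordsBelow {M : Type*} [AddCommMonoid M] (f : Word → M) (N : ℕ) :
    ∑ η ∈ wordsBelow N, f η = ∑ k ∈ Finset.range N, ∑ η ∈ wordsOfLength k, f η := by
  refine Finset.sum_biUnion fun k _ l _ hkl => Finset.disjoint_left.2 fun η hk hl => hkl ?_
  rw [← mem_wordsOfLength.1 hk, ← mem_wordsOfLength.1 hl]

theorem sum_wordsBelow_eq_of_lt {M : Type*} [AddCommMonoid M] (f : Word → M) {m N : ℕ}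
    (hmN : m ≤ N) (hf : ∀ η : Word, m ≤ η.length → f η = 0) :
    ∑ η ∈ wordsBelow N, f η = ∑ η ∈ wordsBelow m, f η := by
  refine (Finset.sum_subset (fun η hη => ?_) fun η _ hη => hf η ?_).symm
  · rw [mem_wordsBelow] at hη ⊢
    omega
  · simpa [mem_wordsBelow] using hη

theorem sum_wordsBelow_eq_single_length {M : Type*} [AddCommMonoid M] (f : Word → M) {m N : ℕ}
    (hmN : m < N) (hf : ∀ η : Word, η.length ≠ m → f η = 0) :
    ∑ η ∈ wordsBelow N, f η = ∑ η ∈ wordsOfLength m, f η := by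
  refine (Finset.sum_subset (fun η hη => ?_) fun η _ hη => hf η ?_).symm
  · rw [mem_wordsBelow, mem_wordsOfLength.1 hη]
    exact hmN
  · simpa [mem_wordsOfLength] using hη

/-- The shuffle product as a sum over a product of finite sets of words. -/
theorem shuffle_eq_sum_wordsBelow (c d : Series) {ν : Word} {N : ℕ} (hν : ν.length < N) :
    shuffle c d ν =
      ∑ η ∈ wordsBelow N, ∑ ξ ∈ wordsBelow N, c η * d ξ * wordShuffle η ξ ν := by
  have hz : ∀ η ξ : Word, η.length + ξ.length ≠ ν.length →
      c η * d ξ * wordShuffle η ξ ν = 0 := fun η ξ h => by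
    rw [wordShuffle_eq_zero η ξ ν h, mul_zero]
  have h1 : ∀ p ∈ Finset.range N, ∀ q ∈ Finset.range N,
      (p, q) ∉ Finset.HasAntidiagonal.antidiagonal ν.length →
      ∑ η ∈ wordsOfLength p, ∑ ξ ∈ wordsOfLength q, c η * d ξ * wordShuffle η ξ ν = 0 := by
    intro p _ q _ h
    refine Finset.sum_eq_zero fun η hη => Finset.sum_eq_zero fun ξ hξ => hz η ξ ?_
    rw [mem_wordsOfLength.1 hη, mem_wordsOfLength.1 hξ]
    simpa using h
  simp only [sum_wordsBelow]
  have h2 : ∀ p, ∑ η ∈ wordsOfLength p, ∑ q ∈ Finset.range N, ∑ ξ ∈ wordsOfLength q,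
        c η * d ξ * wordShuffle η ξ ν
      = ∑ q ∈ Finset.range N, ∑ η ∈ wordsOfLength p, ∑ ξ ∈ wordsOfLength q,
        c η * d ξ * wordShuffle η ξ ν := fun p => Finset.sum_comm
  simp only [h2]
  rw [← Finset.sum_product', shuffle]
  refine Finset.sum_subset (fun p hp => ?_) fun p hp hp' => ?_
  · rw [Finset.HasAntidiagonal.mem_antidiagonal] at hp
    simp only [Finset.mem_product, Finset.mem_range]
    omega
  · rw [Finset.mem_product] at hp
    exact h1 p.1 hp.1 p.2 hp.2 hp'

/-- A truncation that does not depend on ν is what allows the finite sums over η and ν to be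
exchanged. -/
theorem mixedComp_eq_sum_wordsBelow (c : Series) (d : SeriesPair) {ν : Word} {N : ℕ}
    (hν : ν.length < N) :
    mixedComp c d ν = ∑ η ∈ wordsBelow N, c η * phiWord d η (wordSeries []) ν := by
  rw [mixedComp, ← sum_wordsBelow]
  refine (sum_wordsBelow_eq_of_lt _ (by omega) fun η hη => ?_).symm
  rw [phiWord_eq_zero d η ν (by omega), mul_zero]

section RotaBaxter

variable {A : Type*} [CommRing A] [Algebra ℝ A] (I : Fin 2 → A →ₗ[ℝ] A)

/-- The iterated operators `I_{i₁} (I_{i₂} ⋯ (I_{iₙ} 1))`. -/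
def iterOp : Word → A
  | [] => 1
  | i :: η => I i (iterOp η)

/-- Only words beginning with x_i survive, and on these `I i` comes out by linearity: catenation of
series becomes application of the operator. -/
theorem sum_letterMul_smul_iterOp (i : Fin 2) (e : Series) (n : ℕ) :
    ∑ ν ∈ wordsOfLength (n + 1), letterMul i e ν • iterOp I ν =
      I i (∑ ν ∈ wordsOfLength n, e ν • iterOp I ν) := by
  rw [sum_wordsOfLength_succ, Finset.sum_eq_single i]
  · simp [letterMul, iterOp]
  · intro j _ hj
    simp [letterMul, hj]
  · simp

theorem sum_wordSeries_smul_iterOp (η : Word) {n : ℕ} (hn : η.length = n) :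
    ∑ ν ∈ wordsOfLength n, wordSeries η ν • iterOp I ν = iterOp I η := by
  simp [wordSeries, mem_wordsOfLength, hn]

-- The weight-zero Rota–Baxter identity for a family of operators, an abstract integration by parts.
variable (hI : ∀ i j a b, I i a * I j b = I i (a * I j b) + I j (I i a * b))
include hI

/-- Products of iterated Rota–Baxter operators are given by the shuffle product. -/
theorem iterOp_mul_iterOp (η ξ : Word) :
    iterOp I η * iterOp I ξ =
      ∑ ν ∈ wordsOfLength (η.length + ξ.length), wordShuffle η ξ ν • iterOp I ν := by
  induction η generalizing ξ with
  | nil =>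
    simp only [wordShuffle]
    rw [sum_wordSeries_smul_iterOp I ξ (by simp)]
    simp [iterOp]
  | cons i η ih =>
    induction ξ with
    | nil =>
      simp only [wordShuffle]
      rw [sum_wordSeries_smul_iterOp I _ (by simp)]
      simp [iterOp]
    | cons j ξ ihξ =>
      -- `e1` exposes the outer letter of both summands; `e2` rewrites their common remaining length
      -- into the form required by the second induction hypothesis.
      have e1 : (i :: η).length + (j :: ξ).length = (η.length + (j :: ξ).length) + 1 := by
        simp only [List.length_cons]; omega
      have e2 : η.length + (j :: ξ).length = (i :: η).length + ξ.length := by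
        simp only [List.length_cons]; omega
      simp only [wordShuffle, Pi.add_apply, add_smul, Finset.sum_add_distrib]
      rw [e1, sum_letterMul_smul_iterOp, sum_letterMul_smul_iterOp, ← ih, e2, ← ihξ]
      exact hI i j (iterOp I η) (iterOp I ξ)

/-- The sum J of the operators is again Rota–Baxter, and J^n applied to 1 collects all words of
length n. For a single such operator the n-th iterate on 1 is (J 1)^n / n!. -/
theorem sum_pow_eq_factorial_smul_sum_iterOp (n : ℕ) :
    (∑ i, I i 1) ^ n = (n.factorial : ℝ) • ∑ ν ∈ wordsOfLength n, iterOp I ν := by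
  set J : A →ₗ[ℝ] A := ∑ i, I i with hJdef
  have hJ : ∀ a, J a = ∑ i, I i a := fun a => by simp [hJdef]
  have hJJ : ∀ a b, J a * J b = J (a * J b) + J (J a * b) := by
    intro a b
    simp only [hJ, Finset.mul_sum, Finset.sum_mul, map_sum, hI, Finset.sum_add_distrib]
    exact congrArg (· + _) Finset.sum_comm
  set S : ℕ → A := fun n => ∑ ν ∈ wordsOfLength n, iterOp I ν with hS
  have hS0 : S 0 = 1 := by simp [hS, sum_wordsOfLength_zero, iterOp]
  have hSs : ∀ n, S (n + 1) = J (S n) := by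
    intro n
    simp only [hS, sum_wordsOfLength_succ, hJ, map_sum, iterOp]
  -- With S n = J^n applied to 1, the identity splits J 1 * J (S n) into S (n + 2) and J (J 1 * S
  -- n); the latter gives n + 1 further copies of S (n + 2) by induction.
  have key : ∀ n, J 1 * S n = ((n : ℝ) + 1) • S (n + 1) := by
    intro n
    induction n with
    | zero => simp [hS0, hSs]
    | succ n ih =>
      rw [hSs n, hJJ, one_mul, ← hSs, ih, map_smul, ← hSs]
      push_cast
      module
  rw [← hJ]
  change J 1 ^ n = (n.factorial : ℝ) • S n
  induction n with
  | zero => simp [hS0]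
  | succ n ih =>
    rw [pow_succ', ih, mul_smul_comm, key, smul_smul, Nat.factorial_succ]
    push_cast
    rw [mul_comm]

end RotaBaxter

/-! ### Formal Fliess operators -/

/-- With the vanishing constant term, this characterizes `formalInt`; identities between formal
integrals are checked on derivatives and constant terms. -/
theorem derivative_formalInt (f : PowerSeries ℝ) :
    PowerSeries.derivative ℝ (formalInt f) = f := by
  ext n
  rw [PowerSeries.coeff_derivative, formalInt,
    PowerSeries.coeff_succ_X_mul, PowerSeries.coeff_mk]
  field_simp

theorem constantCoeff_formalInt (f : PowerSeries ℝ) :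
    PowerSeries.constantCoeff (formalInt f) = 0 := by
  simp [formalInt]

/-- Formal integration as a linear map, with a weight. -/
noncomputable def formalIntMul (w : PowerSeries ℝ) : PowerSeries ℝ →ₗ[ℝ] PowerSeries ℝ where
  toFun f := formalInt (w * f)
  map_add' f g := by
    refine PowerSeries.derivative.ext ?_ ?_ <;>
      simp [derivative_formalInt, constantCoeff_formalInt, mul_add]
  map_smul' r f := by
    refine PowerSeries.derivative.ext ?_ ?_
    · rw [Derivation.map_smul]
      simp [derivative_formalInt]
    · rw [RingHom.id_apply, PowerSeries.smul_eq_C_mul (formalInt _) r, map_mul,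
        constantCoeff_formalInt, constantCoeff_formalInt, mul_zero]

/-- Formal integration by parts: Leibniz's rule shows that both sides have the same derivative. -/
theorem formalIntMul_mul (w w' f g : PowerSeries ℝ) :
    formalIntMul w f * formalIntMul w' g =
      formalIntMul w (f * formalIntMul w' g) + formalIntMul w' (formalIntMul w f * g) := by
  change formalInt (w * f) * formalInt (w' * g) =
      formalInt (w * (f * formalInt (w' * g))) + formalInt (w' * (formalInt (w * f) * g))
  refine PowerSeries.derivative.ext ?_ ?_
  · rw [Derivation.leibniz, map_add]
    simp only [derivative_formalInt, smul_eq_mul]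
    ring
  · simp [constantCoeff_formalInt]

/-- The input letters `u_0 = 1`, `u_1 = u`. -/
noncomputable def formalLetter (u : PowerSeries ℝ) (i : Fin 2) : PowerSeries ℝ :=
  if i = 0 then 1 else u

theorem formalIterInt_eq_iterOp (u : PowerSeries ℝ) (η : Word) :
    formalIterInt u η = iterOp (fun i => formalIntMul (formalLetter u i)) η := by
  induction η with
  | nil => rfl
  | cons i η ih => simp only [formalIterInt, iterOp, ih]; rfl

theorem formalIterInt_mul (u : PowerSeries ℝ) (η ξ : Word) :
    formalIterInt u η * formalIterInt u ξ =
      ∑ ν ∈ wordsOfLength (η.length + ξ.length), wordShuffle η ξ ν • formalIterInt u ν := by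
  simp only [formalIterInt_eq_iterOp]
  exact iterOp_mul_iterOp _ (fun i j => formalIntMul_mul _ _) η ξ

theorem coeff_formalFliess (c : Series) (u : PowerSeries ℝ) {n N : ℕ} (h : n < N) :
    PowerSeries.coeff n (formalFliess c u) =
      ∑ η ∈ wordsBelow N, c η * PowerSeries.coeff n (formalIterInt u η) := by
  rw [formalFliess, PowerSeries.coeff_mk, ← sum_wordsBelow]
  refine (sum_wordsBelow_eq_of_lt _ h fun η hη => ?_).symm
  rw [coeff_formalIterInt_eq_zero u η n (by omega), mul_zero]

theorem formalFliess_add (c d : Series) (u : PowerSeries ℝ) :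
    formalFliess (c + d) u = formalFliess c u + formalFliess d u := by
  ext n
  simp only [map_add, coeff_formalFliess _ u n.lt_succ_self, Pi.add_apply, add_mul,
    Finset.sum_add_distrib]

theorem formalFliess_one (u : PowerSeries ℝ) : formalFliess (wordSeries []) u = 1 := by
  ext n
  rw [coeff_formalFliess _ u n.lt_succ_self, Finset.sum_eq_single []]
  · simp [wordSeries, formalIterInt]
  · intro η _ hη
    simp [wordSeries, hη]
  · simp [mem_wordsBelow]

theorem formalFliess_letterMul (i : Fin 2) (e : Series) (u : PowerSeries ℝ) :
    formalFliess (letterMul i e) u = formalInt (formalLetter u i * formalFliess e u) := by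
  ext n
  rw [coeff_formalFliess _ u n.lt_succ_self]
  cases n with
  | zero =>
    rw [sum_wordsBelow]
    simp [sum_wordsOfLength_zero, letterMul, formalInt]
  | succ n =>
    have h1 : ∀ η : Word, PowerSeries.coeff (n + 1) (formalIterInt u (i :: η)) =
        PowerSeries.coeff n (formalLetter u i * formalIterInt u η) / ((n : ℝ) + 1) := by
      intro η
      rw [formalIterInt, formalInt, PowerSeries.coeff_succ_X_mul, PowerSeries.coeff_mk]
      rfl
    -- The term split off by `Finset.sum_range_succ'` is the empty word, where `letterMul` vanishes.
    rw [formalInt, PowerSeries.coeff_succ_X_mul, PowerSeries.coeff_mk, sum_wordsBelow,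
      Finset.sum_range_succ', sum_wordsOfLength_zero]
    simp only [letterMul, zero_mul, add_zero, sum_wordsOfLength_succ]
    have h2 : ∀ k, ∑ j : Fin 2, ∑ η ∈ wordsOfLength k, (if j = i then e η else 0) *
          PowerSeries.coeff (n + 1) (formalIterInt u (j :: η)) =
        ∑ η ∈ wordsOfLength k, e η *
          (PowerSeries.coeff n (formalLetter u i * formalIterInt u η) / ((n : ℝ) + 1)) := by
      intro k
      rw [Finset.sum_eq_single i]
      · simp [h1]
      · intro j _ hj
        simp [hj]
      · simp
    simp only [h2, PowerSeries.coeff_mul]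
    rw [← sum_wordsBelow]
    simp only [Finset.sum_div, Finset.mul_sum]
    rw [Finset.sum_comm]
    refine Finset.sum_congr rfl fun p hp => ?_
    rw [Finset.HasAntidiagonal.mem_antidiagonal] at hp
    rw [coeff_formalFliess e u (show p.2 < n + 1 by omega), Finset.mul_sum, Finset.sum_div]
    exact Finset.sum_congr rfl fun η _ => by ring

theorem formalFliess_shuffle (c d : Series) (u : PowerSeries ℝ) :
    formalFliess (shuffle c d) u = formalFliess c u * formalFliess d u := by
  ext n
  have hsh : ∀ η ξ : Word, ∑ ν ∈ wordsBelow (n + 1),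
      wordShuffle η ξ ν * PowerSeries.coeff n (formalIterInt u ν) =
        PowerSeries.coeff n (formalIterInt u η * formalIterInt u ξ) := by
    intro η ξ
    -- The shuffle lives in length |η| + |ξ|, possibly beyond the truncation. Enlarging the
    -- truncation costs nothing, since iterated integrals of words longer than n have zero n-th
    -- coefficient.
    have hN : (n + 1) ≤ max (n + 1) (η.length + ξ.length + 1) := le_max_left _ _
    rw [← sum_wordsBelow_eq_of_lt _ hN, sum_wordsBelow_eq_single_length _
      (m := η.length + ξ.length) (by omega), formalIterInt_mul, map_sum]
    · simp
    · intro ν hν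
      rw [wordShuffle_eq_zero _ _ _ hν.symm, zero_mul]
    · intro ν hν
      rw [coeff_formalIterInt_eq_zero u ν n (by omega), mul_zero]
  have h1 : PowerSeries.coeff n (formalFliess c u * formalFliess d u) =
      ∑ η ∈ wordsBelow (n + 1), ∑ ξ ∈ wordsBelow (n + 1),
        c η * d ξ * PowerSeries.coeff n (formalIterInt u η * formalIterInt u ξ) := by
    simp only [PowerSeries.coeff_mul, Finset.mul_sum]
    have : ∀ η, ∑ ξ ∈ wordsBelow (n + 1), ∑ p ∈ Finset.HasAntidiagonal.antidiagonal n,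
          c η * d ξ * (PowerSeries.coeff p.1 (formalIterInt u η) *
            PowerSeries.coeff p.2 (formalIterInt u ξ)) =
        ∑ p ∈ Finset.HasAntidiagonal.antidiagonal n, ∑ ξ ∈ wordsBelow (n + 1),
          c η * d ξ * (PowerSeries.coeff p.1 (formalIterInt u η) *
            PowerSeries.coeff p.2 (formalIterInt u ξ)) := fun η => Finset.sum_comm
    simp only [this]
    rw [Finset.sum_comm]
    refine Finset.sum_congr rfl fun p hp => ?_
    rw [Finset.HasAntidiagonal.mem_antidiagonal] at hp
    rw [coeff_formalFliess c u (show p.1 < n + 1 by omega),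
      coeff_formalFliess d u (show p.2 < n + 1 by omega), Finset.sum_mul_sum]
    exact Finset.sum_congr rfl fun η _ => Finset.sum_congr rfl fun ξ _ => by ring
  rw [h1, coeff_formalFliess _ u n.lt_succ_self]
  simp only [← hsh, Finset.mul_sum]
  have h2 : ∀ ν ∈ wordsBelow (n + 1), shuffle c d ν * PowerSeries.coeff n (formalIterInt u ν) =
      ∑ η ∈ wordsBelow (n + 1), ∑ ξ ∈ wordsBelow (n + 1),
        c η * d ξ * (wordShuffle η ξ ν * PowerSeries.coeff n (formalIterInt u ν)) := by
    intro ν hν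
    rw [shuffle_eq_sum_wordsBelow c d (mem_wordsBelow.1 hν), Finset.sum_mul]
    refine Finset.sum_congr rfl fun η _ => ?_
    rw [Finset.sum_mul]
    exact Finset.sum_congr rfl fun ξ _ => by ring
  rw [Finset.sum_congr rfl h2, Finset.sum_comm]
  exact Finset.sum_congr rfl fun η _ => Finset.sum_comm

/-- `E_η[F_{d_δ}[u]] = F_{φ_d(η)(1)}[u]`. -/
theorem formalIterInt_formalAffineFliess (d : SeriesPair) (u : PowerSeries ℝ) (η : Word) :
    formalIterInt (formalAffineFliess d u) η = formalFliess (phiWord d η (wordSeries [])) u := by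
  induction η with
  | nil => exact (formalFliess_one u).symm
  | cons i η ih =>
    fin_cases i
    · change formalInt (1 * _) = formalFliess (letterMul 0 (phiWord d η (wordSeries []))) u
      rw [formalFliess_letterMul, ih]
      rfl
    · change formalInt (formalAffineFliess d u * _) =
        formalFliess (letterMul 1 (shuffle d.1 (phiWord d η (wordSeries []))) +
          letterMul 0 (shuffle d.2 (phiWord d η (wordSeries [])))) u
      -- The two summands of φ_d(x_1) match the two summands of the affine operator: u F_{d_L}[u] is
      -- integrated by x_1 and F_{d_R}[u] by x_0.
      rw [formalFliess_add, formalFliess_letterMul, formalFliess_letterMul, formalFliess_shuffle,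
        formalFliess_shuffle, ih, formalAffineFliess]
      change _ = formalInt (u * _) + formalInt (1 * _)
      refine PowerSeries.derivative.ext ?_ ?_
      · simp only [map_add, derivative_formalInt]
        ring
      · simp [constantCoeff_formalInt]

theorem formalFliess_comp_formalAffineFliess (c : Series) (d : SeriesPair) :
    formalFliess c ∘ formalAffineFliess d = formalFliess (mixedComp c d) := by
  funext u
  ext n
  rw [Function.comp_apply, coeff_formalFliess _ _ n.lt_succ_self,
    coeff_formalFliess _ _ n.lt_succ_self]
  simp only [formalIterInt_formalAffineFliess, coeff_formalFliess _ u n.lt_succ_self,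
    Finset.mul_sum]
  rw [Finset.sum_comm]
  refine Finset.sum_congr rfl fun ν hν => ?_
  rw [mixedComp_eq_sum_wordsBelow c d (mem_wordsBelow.1 hν), Finset.sum_mul]
  exact Finset.sum_congr rfl fun η _ => by ring

theorem formalAffineFliess_comp_formalAffineFliess (c d : SeriesPair) :
    formalAffineFliess c ∘ formalAffineFliess d = formalAffineFliess (pairComp c d) := by
  funext u
  have h : ∀ c, formalFliess c (formalAffineFliess d u) = formalFliess (mixedComp c d) u :=
    fun c => congrFun (formalFliess_comp_formalAffineFliess c d) u
  rw [Function.comp_apply, formalAffineFliess, h, h, formalAffineFliess, formalAffineFliess,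
    pairComp, formalFliess_add, formalFliess_shuffle, formalFliess_shuffle]
  ring

/-! ### Iterated integrals of integrable inputs -/

/-- The input functions `u_0 = 1`, `u_1 = u`. -/
def letterInput (u : ℝ → ℝ) (i : Fin 2) (τ : ℝ) : ℝ := if i = 0 then 1 else u τ

theorem iterInt_cons (t₀ : ℝ) (u : ℝ → ℝ) (i : Fin 2) (η : Word) (t : ℝ) :
    iterInt t₀ u (i :: η) t = ∫ τ in t₀..t, letterInput u i τ * iterInt t₀ u η τ := rfl

theorem integrableOn_letterInput {u : ℝ → ℝ} {t₀ t₁ : ℝ} (hu : IntegrableOn u (Set.Icc t₀ t₁))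
    (i : Fin 2) : IntegrableOn (letterInput u i) (Set.Icc t₀ t₁) := by
  unfold letterInput
  split_ifs
  · exact continuousOn_const.integrableOn_Icc
  · exact hu

theorem intervalIntegrable_of_integrableOn_Icc {f : ℝ → ℝ} {t₀ t₁ a b : ℝ}
    (hf : IntegrableOn f (Set.Icc t₀ t₁)) (ha : a ∈ Set.Icc t₀ t₁) (hb : b ∈ Set.Icc t₀ t₁) :
    IntervalIntegrable f volume a b :=
  (hf.mono_set (Set.uIcc_subset_Icc ha hb)).intervalIntegrable

theorem continuousOn_integral_of_integrableOn_Icc {f : ℝ → ℝ} {t₀ t₁ : ℝ}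
    (hf : IntegrableOn f (Set.Icc t₀ t₁)) :
    ContinuousOn (fun t => ∫ τ in t₀..t, f τ) (Set.Icc t₀ t₁) := by
  rcases le_or_gt t₀ t₁ with h | h
  · have := intervalIntegral.continuousOn_primitive_interval (f := f) (a := t₀) (b := t₁)
      (μ := volume)
    rw [Set.uIcc_of_le h] at this
    exact this hf
  · rw [Set.Icc_eq_empty (not_le.2 h)]
    exact continuousOn_empty _

theorem mem_Icc_of_mem_uIcc {t₀ t₁ t τ : ℝ} (ht : t ∈ Set.Icc t₀ t₁) (hτ : τ ∈ Set.uIcc t₀ t) :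
    τ ∈ Set.Icc t₀ t₁ := by
  rw [Set.uIcc_of_le ht.1] at hτ
  exact ⟨hτ.1, hτ.2.trans ht.2⟩

/-- Only values of the input between t₀ and t enter, so u may be cut off outside the interval and
absolute values dropped where the input is nonnegative there. -/
theorem iterInt_congr {u v : ℝ → ℝ} {t₀ t₁ : ℝ} (h : ∀ τ ∈ Set.Icc t₀ t₁, u τ = v τ) (η : Word) :
    ∀ t ∈ Set.Icc t₀ t₁, iterInt t₀ u η t = iterInt t₀ v η t := by
  induction η with
  | nil => exact fun t _ => rfl
  | cons i η ih =>
    intro t ht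
    rw [iterInt_cons, iterInt_cons]
    refine intervalIntegral.integral_congr fun τ hτ => ?_
    have hτ' := mem_Icc_of_mem_uIcc ht hτ
    simp only [letterInput, h τ hτ', ih τ hτ']

theorem continuousOn_iterInt {u : ℝ → ℝ} {t₀ t₁ : ℝ} (hu : IntegrableOn u (Set.Icc t₀ t₁))
    (η : Word) : ContinuousOn (iterInt t₀ u η) (Set.Icc t₀ t₁) := by
  induction η with
  | nil => exact continuousOn_const
  | cons i η ih =>
    exact continuousOn_integral_of_integrableOn_Icc
      ((integrableOn_letterInput hu i).mul_continuousOn ih isCompact_Icc)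

/-- `f ↦ ∫ w f` as a linear map on continuous functions. -/
noncomputable def primitiveMul (w : ℝ → ℝ) (hw : ∀ a b, IntervalIntegrable w volume a b) (t₀ : ℝ) :
    C(ℝ, ℝ) →ₗ[ℝ] C(ℝ, ℝ) where
  toFun f := ⟨fun t => ∫ τ in t₀..t, w τ * f τ, intervalIntegral.continuous_primitive
    (fun a b => (hw a b).mul_continuousOn f.continuous.continuousOn) t₀⟩
  map_add' f g := by
    ext t
    simp only [ContinuousMap.coe_mk, ContinuousMap.add_apply, mul_add]
    exact intervalIntegral.integral_add ((hw _ _).mul_continuousOn f.continuous.continuousOn)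
      ((hw _ _).mul_continuousOn g.continuous.continuousOn)
  map_smul' r f := by
    ext t
    simp only [ContinuousMap.coe_mk, ContinuousMap.smul_apply, smul_eq_mul, RingHom.id_apply,
      ← intervalIntegral.integral_const_mul]
    exact intervalIntegral.integral_congr fun τ _ => by ring

/-- Integration by parts for primitives of integrable functions. -/
theorem integral_mul_integral_eq {f g : ℝ → ℝ} {a b : ℝ} (hf : IntervalIntegrable f volume a b)
    (hg : IntervalIntegrable g volume a b) :
    (∫ τ in a..b, f τ) * ∫ τ in a..b, g τ =
      (∫ τ in a..b, f τ * ∫ σ in a..τ, g σ) + ∫ τ in a..b, g τ * ∫ σ in a..τ, f σ := by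
  -- Primitives of integrable functions are absolutely continuous, so the product rule integrates;
  -- their derivatives are f and g only almost everywhere.
  have haF := hf.absolutelyContinuousOnInterval_intervalIntegral Set.left_mem_uIcc
  have haG := hg.absolutelyContinuousOnInterval_intervalIntegral Set.left_mem_uIcc
  have h := haF.integral_deriv_mul_eq_sub haG
  simp only [intervalIntegral.integral_same, mul_zero, sub_zero] at h
  rw [← h, ← intervalIntegral.integral_add (hf.mul_continuousOn haG.continuousOn)
    (hg.mul_continuousOn haF.continuousOn)]
  refine intervalIntegral.integral_congr_ae ?_
  filter_upwards [hf.ae_hasDerivAt_integral, hg.ae_hasDerivAt_integral] with x hx hx' hxab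
  have hxab' := Set.uIoc_subset_uIcc hxab
  rw [(hx hxab' a Set.left_mem_uIcc).deriv, (hx' hxab' a Set.left_mem_uIcc).deriv]
  ring

theorem primitiveMul_mul {w w' : ℝ → ℝ} (hw : ∀ a b, IntervalIntegrable w volume a b)
    (hw' : ∀ a b, IntervalIntegrable w' volume a b) (t₀ : ℝ) (f g : C(ℝ, ℝ)) :
    primitiveMul w hw t₀ f * primitiveMul w' hw' t₀ g =
      primitiveMul w hw t₀ (f * primitiveMul w' hw' t₀ g) +
        primitiveMul w' hw' t₀ (primitiveMul w hw t₀ f * g) := by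
  ext t
  have h := integral_mul_integral_eq ((hw t₀ t).mul_continuousOn f.continuous.continuousOn)
    ((hw' t₀ t).mul_continuousOn g.continuous.continuousOn)
  simp only [primitiveMul, LinearMap.coe_mk, AddHom.coe_mk, ContinuousMap.mul_apply,
    ContinuousMap.add_apply, ContinuousMap.coe_mk]
  rw [h]
  congr 1 <;> exact intervalIntegral.integral_congr fun τ _ => by ring

/-- Extension by zero makes the weights integrable on every interval, so that the operators act on
the whole ring C(ℝ, ℝ). -/
theorem intervalIntegrable_letterInput_indicator {u : ℝ → ℝ} {t₀ t₁ : ℝ}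
    (hu : IntegrableOn u (Set.Icc t₀ t₁)) (i : Fin 2) (a b : ℝ) :
    IntervalIntegrable (letterInput ((Set.Icc t₀ t₁).indicator u) i) volume a b := by
  unfold letterInput
  split_ifs
  · exact intervalIntegrable_const
  · exact ((integrable_indicator_iff measurableSet_Icc).2 hu).intervalIntegrable

/-- On `[t₀, t₁]` the iterated integrals are iterated Rota–Baxter operators. -/
theorem iterInt_eq_iterOp {u : ℝ → ℝ} {t₀ t₁ t : ℝ} (hu : IntegrableOn u (Set.Icc t₀ t₁))
    (ht : t ∈ Set.Icc t₀ t₁) (η : Word) :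
    iterInt t₀ u η t = iterOp (fun i => primitiveMul (letterInput ((Set.Icc t₀ t₁).indicator u) i)
      (intervalIntegrable_letterInput_indicator hu i) t₀) η t := by
  rw [iterInt_congr (v := (Set.Icc t₀ t₁).indicator u)
    (fun τ hτ => (Set.indicator_of_mem hτ u).symm) η t ht]
  clear ht
  induction η generalizing t with
  | nil => rfl
  | cons i η ih =>
    rw [iterInt_cons]
    simp only [ih]
    rfl

theorem iterInt_mul {u : ℝ → ℝ} {t₀ t₁ t : ℝ} (hu : IntegrableOn u (Set.Icc t₀ t₁))
    (ht : t ∈ Set.Icc t₀ t₁) (η ξ : Word) :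
    iterInt t₀ u η t * iterInt t₀ u ξ t =
      ∑ ν ∈ wordsOfLength (η.length + ξ.length), wordShuffle η ξ ν * iterInt t₀ u ν t := by
  simp only [iterInt_eq_iterOp hu ht]
  rw [← ContinuousMap.mul_apply, iterOp_mul_iterOp _ (fun i j => primitiveMul_mul _ _ t₀),
    ContinuousMap.sum_apply]
  rfl

/-- The power formula evaluated at t, with I_0 1 = t - t₀ and I_1 1 = ∫ u. The factorial will absorb
the growth of locally convergent series. -/
theorem factorial_mul_sum_iterInt {u : ℝ → ℝ} {t₀ t₁ t : ℝ} (hu : IntegrableOn u (Set.Icc t₀ t₁))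
    (ht : t ∈ Set.Icc t₀ t₁) (n : ℕ) :
    (n.factorial : ℝ) * ∑ ν ∈ wordsOfLength n, iterInt t₀ u ν t =
      (t - t₀ + ∫ τ in t₀..t, u τ) ^ n := by
  have h0 : t - t₀ = iterInt t₀ u [0] t := by simp [iterInt]
  have h1 : ∫ τ in t₀..t, u τ = iterInt t₀ u [1] t := by simp [iterInt]
  rw [h0, h1]
  simp only [iterInt_eq_iterOp hu ht]
  have h := congrArg (fun f : C(ℝ, ℝ) => f t) (sum_pow_eq_factorial_smul_sum_iterOp
    (fun i => primitiveMul (letterInput ((Set.Icc t₀ t₁).indicator u) i)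
      (intervalIntegrable_letterInput_indicator hu i) t₀) (fun i j => primitiveMul_mul _ _ t₀) n)
  simp only [Fin.sum_univ_two, ContinuousMap.pow_apply, ContinuousMap.smul_apply,
    ContinuousMap.add_apply, ContinuousMap.sum_apply, smul_eq_mul] at h
  exact h.symm

/-- A general majorant w is allowed because the lemma serves both |u| and the majorant of the
cascade input. -/
theorem abs_iterInt_le {u w : ℝ → ℝ} {t₀ t₁ : ℝ} (hu : IntegrableOn u (Set.Icc t₀ t₁))
    (hw : IntegrableOn w (Set.Icc t₀ t₁)) (h : ∀ τ ∈ Set.Icc t₀ t₁, |u τ| ≤ w τ) (η : Word) :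
    ∀ t ∈ Set.Icc t₀ t₁, |iterInt t₀ u η t| ≤ iterInt t₀ w η t := by
  induction η with
  | nil => simp [iterInt]
  | cons i η ih =>
    intro t ht
    have h0 : t₀ ∈ Set.Icc t₀ t₁ := ⟨le_rfl, ht.1.trans ht.2⟩
    have hint : ∀ {v : ℝ → ℝ}, IntegrableOn v (Set.Icc t₀ t₁) →
        IntervalIntegrable (fun τ => letterInput v i τ * iterInt t₀ v η τ) volume t₀ t :=
      fun hv => intervalIntegrable_of_integrableOn_Icc
        ((integrableOn_letterInput hv i).mul_continuousOn (continuousOn_iterInt hv η)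
          isCompact_Icc) h0 ht
    rw [iterInt_cons, iterInt_cons]
    refine (intervalIntegral.abs_integral_le_integral_abs ht.1).trans
      (intervalIntegral.integral_mono_on ht.1 (hint hu).abs (hint hw) fun τ hτ => ?_)
    have hτ' : τ ∈ Set.Icc t₀ t₁ := ⟨hτ.1, hτ.2.trans ht.2⟩
    have hl : |letterInput u i τ| ≤ letterInput w i τ := by
      unfold letterInput
      split_ifs
      · simp
      · exact h τ hτ'
    rw [abs_mul]
    exact mul_le_mul hl (ih τ hτ') (abs_nonneg _) ((abs_nonneg _).trans hl)

theorem iterInt_abs_nonneg {u : ℝ → ℝ} {t₀ t : ℝ} (hu : IntegrableOn u (Set.Icc t₀ t))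
    (ht : t₀ ≤ t) (η : Word) : 0 ≤ iterInt t₀ (fun τ => |u τ|) η t :=
  (abs_nonneg _).trans (abs_iterInt_le hu hu.abs (fun _ _ => le_rfl) η t ⟨ht, le_rfl⟩)

theorem letterInput_abs_nonneg (u : ℝ → ℝ) (i : Fin 2) (τ : ℝ) :
    0 ≤ letterInput (fun τ => |u τ|) i τ := by
  unfold letterInput
  split_ifs
  · exact zero_le_one
  · exact abs_nonneg _

theorem iterInt_abs_mono {u : ℝ → ℝ} {t₀ t₁ t : ℝ} (hu : IntegrableOn u (Set.Icc t₀ t₁))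
    (ht : t ∈ Set.Icc t₀ t₁) (η : Word) :
    iterInt t₀ (fun τ => |u τ|) η t ≤ iterInt t₀ (fun τ => |u τ|) η t₁ := by
  cases η with
  | nil => exact le_rfl
  | cons i η =>
    have h1 : t₀ ≤ t₁ := ht.1.trans ht.2
    rw [iterInt_cons, iterInt_cons]
    refine intervalIntegral.integral_mono_interval le_rfl ht.1 ht.2 ?_
      (intervalIntegrable_of_integrableOn_Icc ((integrableOn_letterInput hu.abs i).mul_continuousOn
        (continuousOn_iterInt hu.abs η) isCompact_Icc) ⟨le_rfl, h1⟩ ⟨h1, le_rfl⟩)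
    filter_upwards [ae_restrict_mem measurableSet_Ioc] with τ hτ
    exact mul_nonneg (letterInput_abs_nonneg u i τ)
      (iterInt_abs_nonneg (hu.mono_set (Set.Icc_subset_Icc_right hτ.2)) hτ.1.le η)

/-! ### Absolutely convergent Fliess operators -/

section

variable {c d e : Series} {u : ℝ → ℝ} {t₀ t₁ t : ℝ}

theorem AbsConverges.mono (hc : AbsConverges c t₀ u t₁) (hu : IntegrableOn u (Set.Icc t₀ t₁))
    (ht : t ∈ Set.Icc t₀ t₁) : AbsConverges c t₀ u t :=
  Summable.of_nonneg_of_le (fun η => mul_nonneg (abs_nonneg _)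
      (iterInt_abs_nonneg (hu.mono_set (Set.Icc_subset_Icc_right ht.2)) ht.1 η))
    (fun η => mul_le_mul_of_nonneg_left (iterInt_abs_mono hu ht η) (abs_nonneg _)) hc

theorem norm_mul_iterInt_le (hu : IntegrableOn u (Set.Icc t₀ t₁)) (ht : t ∈ Set.Icc t₀ t₁)
    (c : Series) (η : Word) :
    ‖c η * iterInt t₀ u η t‖ ≤ |c η| * iterInt t₀ (fun τ => |u τ|) η t := by
  rw [norm_mul]
  exact mul_le_mul_of_nonneg_left
    (abs_iterInt_le hu hu.abs (fun _ _ => le_rfl) η t ht) (abs_nonneg _)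

theorem AbsConverges.summable_norm (hc : AbsConverges c t₀ u t)
    (hu : IntegrableOn u (Set.Icc t₀ t)) (ht : t₀ ≤ t) :
    Summable fun η => ‖c η * iterInt t₀ u η t‖ :=
  Summable.of_nonneg_of_le (fun _ => norm_nonneg _)
    (norm_mul_iterInt_le hu ⟨ht, le_rfl⟩ c) hc

theorem AbsConverges.hasSum (hc : AbsConverges c t₀ u t)
    (hu : IntegrableOn u (Set.Icc t₀ t)) (ht : t₀ ≤ t) :
    HasSum (fun η => c η * iterInt t₀ u η t) (fliess c t₀ u t) :=
  (hc.summable_norm hu ht).of_norm.hasSum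

/-- Weierstrass M-test: the terms at t₁ dominate those at earlier times. -/
theorem AbsConverges.continuousOn_fliess (hc : AbsConverges c t₀ u t₁)
    (hu : IntegrableOn u (Set.Icc t₀ t₁)) : ContinuousOn (fliess c t₀ u) (Set.Icc t₀ t₁) :=
  continuousOn_tsum (fun η => continuousOn_const.mul (continuousOn_iterInt hu η)) hc
    fun η _ hτ => (norm_mul_iterInt_le hu hτ c η).trans
      (mul_le_mul_of_nonneg_left (iterInt_abs_mono hu hτ η) (abs_nonneg _))

theorem AbsConverges.abs (hc : AbsConverges c t₀ u t) :
    AbsConverges (fun η => |c η|) t₀ (fun τ => |u τ|) t := by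
  simpa only [AbsConverges, abs_abs] using hc

theorem AbsConverges.abs_fliess_le (hc : AbsConverges c t₀ u t)
    (hu : IntegrableOn u (Set.Icc t₀ t)) (ht : t₀ ≤ t) :
    |fliess c t₀ u t| ≤ fliess (fun η => |c η|) t₀ (fun τ => |u τ|) t :=
  tsum_of_norm_bounded (Summable.hasSum hc) (norm_mul_iterInt_le hu ⟨ht, le_rfl⟩ c)

theorem AbsConverges.add (hc : AbsConverges c t₀ u t) (hd : AbsConverges d t₀ u t)
    (hu : IntegrableOn u (Set.Icc t₀ t)) (ht : t₀ ≤ t) : AbsConverges (c + d) t₀ u t := by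
  refine Summable.of_nonneg_of_le
    (fun η => mul_nonneg (abs_nonneg _) (iterInt_abs_nonneg hu ht η)) (fun η => ?_)
    (Summable.add hc hd)
  rw [← add_mul]
  exact mul_le_mul_of_nonneg_right (abs_add_le _ _) (iterInt_abs_nonneg hu ht η)

theorem fliess_add (hc : AbsConverges c t₀ u t) (hd : AbsConverges d t₀ u t)
    (hu : IntegrableOn u (Set.Icc t₀ t)) (ht : t₀ ≤ t) :
    fliess (c + d) t₀ u t = fliess c t₀ u t + fliess d t₀ u t := by
  refine HasSum.tsum_eq ?_
  simp only [Pi.add_apply, add_mul]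
  exact (hc.hasSum hu ht).add (hd.hasSum hu ht)

theorem hasSum_wordSeries_nil (f : Word → ℝ) :
    HasSum (fun η => wordSeries [] η * f η) (f []) := by
  have h := hasSum_single (f := fun η => wordSeries [] η * f η) []
    fun η hη => by simp [wordSeries, hη]
  simpa [wordSeries] using h

theorem absConverges_wordSeries_nil (t₀ : ℝ) (u : ℝ → ℝ) (t : ℝ) :
    AbsConverges (wordSeries []) t₀ u t := by
  refine (hasSum_wordSeries_nil fun η => iterInt t₀ (fun τ => |u τ|) η t).summable.congr fun η => ?_
  rw [abs_of_nonneg]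
  unfold wordSeries
  split_ifs <;> norm_num

theorem fliess_wordSeries_nil (t₀ : ℝ) (u : ℝ → ℝ) (t : ℝ) :
    fliess (wordSeries []) t₀ u t = 1 :=
  (hasSum_wordSeries_nil fun η => iterInt t₀ u η t).tsum_eq

theorem hasSum_letterMul_iff (i : Fin 2) (e : Series) (f : Word → ℝ) (a : ℝ) :
    HasSum (fun η => letterMul i e η * f η) a ↔ HasSum (fun η => e η * f (i :: η)) a := by
  have hinj : Function.Injective fun η : Word => i :: η := List.cons_injective
  rw [← hinj.hasSum_iff]
  · simp [Function.comp_def, letterMul]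
  · intro η hη
    cases η with
    | nil => simp [letterMul]
    | cons j η =>
      have : j ≠ i := by
        rintro rfl
        exact hη ⟨η, rfl⟩
      simp [letterMul, this]

/-- The termwise integrals converge absolutely. -/
theorem AbsConverges.summable_integral (he : AbsConverges e t₀ u t₁)
    (hu : IntegrableOn u (Set.Icc t₀ t₁)) (h01 : t₀ ≤ t₁) (i : Fin 2) :
    Summable fun η => |e η| * iterInt t₀ (fun τ => |u τ|) (i :: η) t₁ := by
  have h0 : t₀ ∈ Set.Icc t₀ t₁ := ⟨le_rfl, h01⟩
  have h1 : t₁ ∈ Set.Icc t₀ t₁ := ⟨h01, le_rfl⟩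
  refine Summable.of_nonneg_of_le
    (fun η => mul_nonneg (abs_nonneg _) (iterInt_abs_nonneg hu h01 _)) (fun η => ?_)
    -- Replacing E_η[|u|](τ) by its value at t₁ bounds each integral by one constant times the η-th
    -- term of the convergent series.
    (Summable.mul_left (∫ τ in t₀..t₁, letterInput (fun τ => |u τ|) i τ) he)
  rw [mul_left_comm]
  refine mul_le_mul_of_nonneg_left ?_ (abs_nonneg _)
  rw [iterInt_cons, ← intervalIntegral.integral_mul_const]
  have hl := integrableOn_letterInput hu.abs i
  refine intervalIntegral.integral_mono_on h01
    (intervalIntegrable_of_integrableOn_Icc (hl.mul_continuousOn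
      (continuousOn_iterInt hu.abs η) isCompact_Icc) h0 h1)
    ((intervalIntegrable_of_integrableOn_Icc hl h0 h1).mul_const _) fun τ hτ => ?_
  exact mul_le_mul_of_nonneg_left (iterInt_abs_mono hu hτ η) (letterInput_abs_nonneg u i τ)

theorem AbsConverges.letterMul (he : AbsConverges e t₀ u t)
    (hu : IntegrableOn u (Set.Icc t₀ t)) (ht : t₀ ≤ t) (i : Fin 2) :
    AbsConverges (letterMul i e) t₀ u t := by
  have h := ((hasSum_letterMul_iff i (fun η => |e η|)
    (fun η => iterInt t₀ (fun τ => |u τ|) η t) _).2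
      (he.summable_integral hu ht i).hasSum).summable
  refine h.congr fun η => ?_
  congr 1
  cases η with
  | nil => simp [Fliess.letterMul]
  | cons j η =>
    simp only [Fliess.letterMul]
    split_ifs <;> simp

/-- Termwise integration, justified by summability of the L_1 norms of the terms. -/
theorem fliess_letterMul (he : AbsConverges e t₀ u t)
    (hu : IntegrableOn u (Set.Icc t₀ t)) (ht : t₀ ≤ t) (i : Fin 2) :
    fliess (letterMul i e) t₀ u t = ∫ τ in t₀..t, letterInput u i τ * fliess e t₀ u τ := by
  refine HasSum.tsum_eq ((hasSum_letterMul_iff i e _ _).2 ?_)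
  have hint : ∀ {v : ℝ → ℝ}, IntegrableOn v (Set.Icc t₀ t) → ∀ η,
      IntegrableOn (fun τ => letterInput v i τ * iterInt t₀ v η τ) (Set.Icc t₀ t) :=
    fun hv η => (integrableOn_letterInput hv i).mul_continuousOn
      (continuousOn_iterInt hv η) isCompact_Icc
  have hF : ∀ η, Integrable (fun τ => e η * (letterInput u i τ * iterInt t₀ u η τ))
      (volume.restrict (Set.Ioc t₀ t)) := fun η =>
    ((hint hu η).mono_set Set.Ioc_subset_Icc_self).const_mul _
  have hsum : Summable fun η => ∫ τ, ‖e η * (letterInput u i τ * iterInt t₀ u η τ)‖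
      ∂(volume.restrict (Set.Ioc t₀ t)) := by
    refine Summable.of_nonneg_of_le (fun η => integral_nonneg fun _ => norm_nonneg _)
      (fun η => ?_) (he.summable_integral hu ht i)
    rw [iterInt_cons, intervalIntegral.integral_of_le ht, ← integral_const_mul]
    refine setIntegral_mono_on (hF η).norm
      (((hint hu.abs η).mono_set Set.Ioc_subset_Icc_self).const_mul _) measurableSet_Ioc
      fun τ hτ => ?_
    rw [norm_mul, norm_mul, Real.norm_eq_abs, Real.norm_eq_abs, Real.norm_eq_abs]
    have hl : |letterInput u i τ| = letterInput (fun τ => |u τ|) i τ := by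
      unfold letterInput
      split_ifs <;> simp
    rw [hl]
    exact mul_le_mul_of_nonneg_left (mul_le_mul_of_nonneg_left (abs_iterInt_le hu hu.abs
      (fun _ _ => le_rfl) η τ ⟨hτ.1.le, hτ.2⟩) (letterInput_abs_nonneg u i τ)) (abs_nonneg _)
  have h := hasSum_integral_of_summable_integral_norm hF hsum
  have hterm : (fun η => e η * iterInt t₀ u (i :: η) t) = fun η =>
      ∫ τ in Set.Ioc t₀ t, e η * (letterInput u i τ * iterInt t₀ u η τ) := by
    funext η
    rw [integral_const_mul, iterInt_cons, intervalIntegral.integral_of_le ht]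
  have hlim : ∫ τ in t₀..t, letterInput u i τ * fliess e t₀ u τ =
      ∫ τ in Set.Ioc t₀ t, ∑' η, e η * (letterInput u i τ * iterInt t₀ u η τ) := by
    rw [intervalIntegral.integral_of_le ht]
    refine integral_congr_ae (Filter.Eventually.of_forall fun τ => ?_)
    simp only [fliess, ← tsum_mul_left]
    exact tsum_congr fun η => by ring
  rw [hterm, hlim]
  exact h

end

/-! ### Interchange of summation -/

section

variable {ι κ : Type*} {G H : ι → κ → ℝ} {a b : ι → ℝ} {g : κ → ℝ}

theorem summable_prod_of_hasSum_rows (hH : ∀ i k, 0 ≤ H i k) (hrow : ∀ i, HasSum (H i) (b i))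
    (hb : Summable b) : Summable fun p : ι × κ => H p.1 p.2 := by
  refine (summable_prod_of_nonneg fun p => hH p.1 p.2).2 ⟨fun i => (hrow i).summable, ?_⟩
  simpa only [(hrow _).tsum_eq] using hb

/-- Tonelli: a nonnegative array with summable row sums has summable column sums. Columns are the
coefficients of the resulting series, computed by finite sums. -/
theorem summable_of_le_sum_columns (hH : ∀ i k, 0 ≤ H i k) (hrow : ∀ i, HasSum (H i) (b i))
    (hb : Summable b) (hg : ∀ k, 0 ≤ g k) (s : κ → Finset ι)
    (hcol : ∀ k, g k ≤ ∑ i ∈ s k, H i k) : Summable g := by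
  have h := (summable_prod_of_hasSum_rows hH hrow hb).prod_symm
  refine Summable.of_nonneg_of_le hg (fun k => (hcol k).trans ?_) h.prod
  exact (h.prod_factor k).sum_le_tsum _ fun i _ => hH i k

/-- Fubini for an array dominated by one with summable row sums; the columns have finite support. -/
theorem tsum_columns_eq_tsum_rows (hGH : ∀ i k, |G i k| ≤ H i k)
    (hrow : ∀ i, HasSum (H i) (b i)) (hb : Summable b) (hG : ∀ i, HasSum (G i) (a i))
    (s : κ → Finset ι) (hs : ∀ k, ∀ i ∉ s k, G i k = 0) (hcol : ∀ k, ∑ i ∈ s k, G i k = g k) :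
    ∑' k, g k = ∑' i, a i := by
  have hH := summable_prod_of_hasSum_rows (fun i k => (abs_nonneg _).trans (hGH i k)) hrow hb
  have hGs : Summable (Function.uncurry G) :=
    Summable.of_norm_bounded hH fun p => hGH p.1 p.2
  have h := hGs.tsum_comm
  simp only [(hG _).tsum_eq] at h
  rw [← h]
  refine tsum_congr fun k => ?_
  rw [← hcol k, tsum_eq_sum (s := s k) (hs k)]

end

/-! ### Shuffle products of Fliess operators -/

theorem wordSeries_nonneg (η ν : Word) : 0 ≤ wordSeries η ν := by
  unfold wordSeries
  split_ifs <;> norm_num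

theorem abs_letterMul_le {i : Fin 2} {e e' : Series} (h : ∀ ν, |e ν| ≤ e' ν) (ν : Word) :
    |letterMul i e ν| ≤ letterMul i e' ν := by
  cases ν with
  | nil => simp [letterMul]
  | cons j ν =>
    simp only [letterMul]
    split_ifs
    · exact h ν
    · simp

/-- Positivity lets absolute values pass inside shuffles, hence inside φ_d, with |d| as majorant. -/
theorem wordShuffle_nonneg (η ξ ν : Word) : 0 ≤ wordShuffle η ξ ν := by
  induction ν generalizing η ξ with
  | nil =>
    cases η with
    | nil => simp only [wordShuffle, wordSeries_nonneg]
    | cons i η =>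
      cases ξ with
      | nil => simp only [wordShuffle, wordSeries_nonneg]
      | cons j ξ => simp [wordShuffle, letterMul]
  | cons k ν ih =>
    cases η with
    | nil => simp only [wordShuffle, wordSeries_nonneg]
    | cons i η =>
      cases ξ with
      | nil => simp only [wordShuffle, wordSeries_nonneg]
      | cons j ξ =>
        simp only [wordShuffle, Pi.add_apply, letterMul]
        split_ifs <;> simp [ih, add_nonneg]

theorem abs_shuffle_le {c c' e e' : Series} (hc : ∀ ν, |c ν| ≤ c' ν) (he : ∀ ν, |e ν| ≤ e' ν)
    (ν : Word) : |shuffle c e ν| ≤ shuffle c' e' ν := by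
  unfold shuffle
  refine (Finset.abs_sum_le_sum_abs _ _).trans (Finset.sum_le_sum fun p _ => ?_)
  refine (Finset.abs_sum_le_sum_abs _ _).trans (Finset.sum_le_sum fun η _ => ?_)
  refine (Finset.abs_sum_le_sum_abs _ _).trans (Finset.sum_le_sum fun ξ _ => ?_)
  rw [abs_mul, abs_mul, abs_of_nonneg (wordShuffle_nonneg η ξ ν)]
  exact mul_le_mul_of_nonneg_right (mul_le_mul (hc η) (he ξ) (abs_nonneg _)
    ((abs_nonneg _).trans (hc η))) (wordShuffle_nonneg η ξ ν)

theorem abs_phiWord_le (d : SeriesPair) (η ν : Word) :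
    |phiWord d η (wordSeries []) ν| ≤ phiWord (absPair d) η (wordSeries []) ν := by
  induction η generalizing ν with
  | nil => exact (abs_of_nonneg (wordSeries_nonneg [] ν)).le
  | cons i η ih =>
    fin_cases i
    · exact abs_letterMul_le ih ν
    · exact (abs_add_le _ _).trans (add_le_add
        (abs_letterMul_le (abs_shuffle_le (fun _ => le_rfl) ih) ν)
        (abs_letterMul_le (abs_shuffle_le (fun _ => le_rfl) ih) ν))

section

variable {c d : Series} {u : ℝ → ℝ} {t₀ t₁ t : ℝ}

theorem hasSum_wordShuffle (hu : IntegrableOn u (Set.Icc t₀ t)) (ht : t₀ ≤ t) (η ξ : Word) :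
    HasSum (fun ν => wordShuffle η ξ ν * iterInt t₀ u ν t)
      (iterInt t₀ u η t * iterInt t₀ u ξ t) := by
  rw [iterInt_mul hu ⟨ht, le_rfl⟩]
  refine hasSum_sum_of_ne_finset_zero fun ν hν => ?_
  rw [wordShuffle_eq_zero η ξ ν fun h => hν (mem_wordsOfLength.2 h.symm), zero_mul]

theorem hasSum_mul_wordShuffle (c d : Series) (hu : IntegrableOn u (Set.Icc t₀ t)) (ht : t₀ ≤ t)
    (p : Word × Word) :
    HasSum (fun ν => c p.1 * d p.2 * wordShuffle p.1 p.2 ν * iterInt t₀ u ν t)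
      (c p.1 * iterInt t₀ u p.1 t * (d p.2 * iterInt t₀ u p.2 t)) := by
  rw [mul_mul_mul_comm]
  simpa only [mul_assoc] using (hasSum_wordShuffle hu ht p.1 p.2).mul_left (c p.1 * d p.2)

theorem AbsConverges.summable_mul (hc : AbsConverges c t₀ u t) (hd : AbsConverges d t₀ u t)
    (hu : IntegrableOn u (Set.Icc t₀ t)) (ht : t₀ ≤ t) :
    Summable fun p : Word × Word => |c p.1| * iterInt t₀ (fun τ => |u τ|) p.1 t *
      (|d p.2| * iterInt t₀ (fun τ => |u τ|) p.2 t) :=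
  Summable.mul_of_nonneg hc hd
    (fun η => mul_nonneg (abs_nonneg _) (iterInt_abs_nonneg hu ht η))
    (fun η => mul_nonneg (abs_nonneg _) (iterInt_abs_nonneg hu ht η))

theorem shuffle_eq_sum_product (c d : Series) (ν : Word) :
    shuffle c d ν = ∑ p ∈ wordsBelow (ν.length + 1) ×ˢ wordsBelow (ν.length + 1),
      c p.1 * d p.2 * wordShuffle p.1 p.2 ν := by
  rw [shuffle_eq_sum_wordsBelow c d ν.length.lt_succ_self, Finset.sum_product]

theorem AbsConverges.shuffle (hc : AbsConverges c t₀ u t) (hd : AbsConverges d t₀ u t)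
    (hu : IntegrableOn u (Set.Icc t₀ t)) (ht : t₀ ≤ t) :
    AbsConverges (shuffle c d) t₀ u t := by
  refine summable_of_le_sum_columns (fun p ν => ?_)
    (hasSum_mul_wordShuffle (fun η => |c η|) (fun η => |d η|) hu.abs ht)
    (hc.summable_mul hd hu ht)
    (fun ν => mul_nonneg (abs_nonneg _) (iterInt_abs_nonneg hu ht ν))
    (fun ν => wordsBelow (ν.length + 1) ×ˢ wordsBelow (ν.length + 1)) fun ν => ?_
  · exact mul_nonneg (mul_nonneg (mul_nonneg (abs_nonneg _) (abs_nonneg _))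
      (wordShuffle_nonneg _ _ _)) (iterInt_abs_nonneg hu ht ν)
  · rw [← Finset.sum_mul, ← shuffle_eq_sum_product (fun η => |c η|) (fun η => |d η|)]
    exact mul_le_mul_of_nonneg_right (abs_shuffle_le (fun _ => le_rfl) (fun _ => le_rfl) ν)
      (iterInt_abs_nonneg hu ht ν)

/-- Rows are pairs (η, ξ) and columns are words ν. Each row sums to a product of two terms by the
shuffle formula for iterated integrals, and each column to a shuffle coefficient times E_ν. -/
theorem fliess_shuffle (hc : AbsConverges c t₀ u t) (hd : AbsConverges d t₀ u t)
    (hu : IntegrableOn u (Set.Icc t₀ t)) (ht : t₀ ≤ t) :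
    fliess (shuffle c d) t₀ u t = fliess c t₀ u t * fliess d t₀ u t := by
  rw [fliess, fliess, fliess,
    tsum_mul_tsum_of_summable_norm (hc.summable_norm hu ht) (hd.summable_norm hu ht)]
  refine tsum_columns_eq_tsum_rows (fun p ν => ?_)
    (hasSum_mul_wordShuffle (fun η => |c η|) (fun η => |d η|) hu.abs ht)
    (hc.summable_mul hd hu ht) (hasSum_mul_wordShuffle c d hu ht)
    (fun ν => wordsBelow (ν.length + 1) ×ˢ wordsBelow (ν.length + 1)) (fun ν p hp => ?_)
    fun ν => ?_
  · rw [abs_mul, abs_mul, abs_mul, abs_of_nonneg (wordShuffle_nonneg _ _ ν)]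
    exact mul_le_mul_of_nonneg_left (abs_iterInt_le hu hu.abs (fun _ _ => le_rfl) ν t ⟨ht, le_rfl⟩)
      (mul_nonneg (mul_nonneg (abs_nonneg _) (abs_nonneg _)) (wordShuffle_nonneg _ _ _))
  · rw [wordShuffle_eq_zero, mul_zero, zero_mul]
    intro h
    refine hp (Finset.mem_product.2 ⟨mem_wordsBelow.2 ?_, mem_wordsBelow.2 ?_⟩) <;> omega
  · rw [← Finset.sum_mul, ← shuffle_eq_sum_product]

end

/-! ### Cascades of Fliess operators -/

section

variable {c : Series} {d : SeriesPair} {u : ℝ → ℝ} {t₀ t₁ t : ℝ}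

theorem integrableOn_affineFliess (hu : IntegrableOn u (Set.Icc t₀ t₁))
    (h1 : AbsConverges d.1 t₀ u t₁) (h2 : AbsConverges d.2 t₀ u t₁) :
    IntegrableOn (affineFliess d t₀ u) (Set.Icc t₀ t₁) :=
  (hu.mul_continuousOn (h1.continuousOn_fliess hu) isCompact_Icc).add
    (h2.continuousOn_fliess hu).integrableOn_Icc

theorem AbsConverges.phiWord (hu : IntegrableOn u (Set.Icc t₀ t)) (ht : t₀ ≤ t)
    (h1 : AbsConverges d.1 t₀ u t) (h2 : AbsConverges d.2 t₀ u t) (η : Word) :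
    AbsConverges (phiWord d η (wordSeries [])) t₀ u t := by
  induction η with
  | nil => exact absConverges_wordSeries_nil t₀ u t
  | cons i η ih =>
    fin_cases i
    · exact ih.letterMul hu ht 0
    · exact ((h1.shuffle ih hu ht).letterMul hu ht 1).add
        ((h2.shuffle ih hu ht).letterMul hu ht 0) hu ht

/-- `E_η[F_{d_δ}[u]] = F_{φ_d(η)(1)}[u]`. -/
theorem iterInt_affineFliess (hu : IntegrableOn u (Set.Icc t₀ t)) (ht : t₀ ≤ t)
    (h1 : AbsConverges d.1 t₀ u t) (h2 : AbsConverges d.2 t₀ u t) (η : Word) :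
    iterInt t₀ (affineFliess d t₀ u) η t = fliess (phiWord d η (wordSeries [])) t₀ u t := by
  induction η generalizing t with
  | nil => exact (fliess_wordSeries_nil t₀ u t).symm
  | cons i η ih =>
    -- The outer integral needs the identity at every earlier time τ, hence the induction with t
    -- general.
    have ih' : ∀ τ ∈ Set.Icc t₀ t, iterInt t₀ (affineFliess d t₀ u) η τ =
        fliess (Fliess.phiWord d η (wordSeries [])) t₀ u τ := fun τ hτ =>
      ih (hu.mono_set (Set.Icc_subset_Icc_right hτ.2)) hτ.1 (h1.mono hu hτ) (h2.mono hu hτ)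
    have hφ := AbsConverges.phiWord hu ht h1 h2 η
    rw [iterInt_cons]
    fin_cases i
    · refine Eq.trans ?_ (fliess_letterMul hφ hu ht 0).symm
      refine intervalIntegral.integral_congr fun τ hτ => ?_
      rw [Set.uIcc_of_le ht] at hτ
      simp only [ih' τ hτ]
      rfl
    · have hs1 := h1.shuffle hφ hu ht
      have hs2 := h2.shuffle hφ hu ht
      have hint : ∀ {e : Series} (i : Fin 2), AbsConverges e t₀ u t →
          IntervalIntegrable (fun τ => letterInput u i τ * fliess e t₀ u τ) volume t₀ t :=
        fun i he => intervalIntegrable_of_integrableOn_Icc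
          ((integrableOn_letterInput hu i).mul_continuousOn (he.continuousOn_fliess hu)
            isCompact_Icc) ⟨le_rfl, ht⟩ ⟨ht, le_rfl⟩
      refine Eq.trans ?_ (fliess_add (hs1.letterMul hu ht 1) (hs2.letterMul hu ht 0) hu ht).symm
      rw [fliess_letterMul hs1 hu ht, fliess_letterMul hs2 hu ht,
        ← intervalIntegral.integral_add (hint 1 hs1) (hint 0 hs2)]
      refine intervalIntegral.integral_congr fun τ hτ => ?_
      rw [Set.uIcc_of_le ht] at hτ
      have huτ := hu.mono_set (Set.Icc_subset_Icc_right hτ.2)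
      simp only [ih' τ hτ]
      rw [fliess_shuffle (h1.mono hu hτ) (hφ.mono hu hτ) huτ hτ.1,
        fliess_shuffle (h2.mono hu hτ) (hφ.mono hu hτ) huτ hτ.1]
      simp only [letterInput, affineFliess, Fin.mk_one, one_ne_zero, if_false, if_true, one_mul]
      ring

theorem abs_affineFliess_le (hu : IntegrableOn u (Set.Icc t₀ t)) (ht : t₀ ≤ t)
    (h1 : AbsConverges d.1 t₀ u t) (h2 : AbsConverges d.2 t₀ u t) :
    |affineFliess d t₀ u t| ≤ affineFliess (absPair d) t₀ (fun τ => |u τ|) t := by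
  refine (abs_add_le _ _).trans (add_le_add ?_ (h2.abs_fliess_le hu ht))
  rw [abs_mul]
  exact mul_le_mul_of_nonneg_left (h1.abs_fliess_le hu ht) (abs_nonneg _)

theorem CascadeConverges.mono (h : CascadeConverges c d t₀ t₁ u)
    (hu : IntegrableOn u (Set.Icc t₀ t₁)) (ht : t ∈ Set.Icc t₀ t₁) :
    CascadeConverges c d t₀ t u :=
  ⟨h.1.mono hu ht, h.2.1.mono hu ht, h.2.2.mono
    (integrableOn_affineFliess (d := absPair d) hu.abs h.1.abs h.2.1.abs) ht⟩

/-- Pointwise |F_{d_δ}[u]| ≤ V, and iterated integrals are monotone in a nonnegative input. -/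
theorem CascadeConverges.absConverges_affineFliess (h : CascadeConverges c d t₀ t u)
    (hu : IntegrableOn u (Set.Icc t₀ t)) (ht : t₀ ≤ t) :
    AbsConverges c t₀ (affineFliess d t₀ u) t := by
  have hv := integrableOn_affineFliess hu h.1 h.2.1
  have hV := integrableOn_affineFliess (d := absPair d) hu.abs h.1.abs h.2.1.abs
  refine Summable.of_nonneg_of_le
    (fun η => mul_nonneg (abs_nonneg _) (iterInt_abs_nonneg hv ht η))
    (fun η => mul_le_mul_of_nonneg_left ?_ (abs_nonneg _)) h.2.2
  refine (le_abs_self _).trans (abs_iterInt_le hv.abs hV.abs (fun τ hτ => ?_) η t ⟨ht, le_rfl⟩)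
  rw [abs_abs]
  exact (abs_affineFliess_le (hu.mono_set (Set.Icc_subset_Icc_right hτ.2)) hτ.1
    (h.1.mono hu hτ) (h.2.1.mono hu hτ)).trans (le_abs_self _)

/-- The rows of the double series majorizing the cascade. -/
theorem CascadeConverges.hasSum_phiWord_absPair (h : CascadeConverges c d t₀ t u)
    (hu : IntegrableOn u (Set.Icc t₀ t)) (ht : t₀ ≤ t) (η : Word) :
    HasSum (fun ν => |c η| * phiWord (absPair d) η (wordSeries []) ν *
        iterInt t₀ (fun τ => |u τ|) ν t)
      (|c η| * iterInt t₀ (fun τ => |affineFliess (absPair d) t₀ (fun τ => |u τ|) τ|) η t) := by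
  have hV : ∀ τ ∈ Set.Icc t₀ t, |affineFliess (absPair d) t₀ (fun τ => |u τ|) τ| =
      affineFliess (absPair d) t₀ (fun τ => |u τ|) τ := fun τ hτ =>
    abs_of_nonneg ((abs_nonneg _).trans (abs_affineFliess_le
      (hu.mono_set (Set.Icc_subset_Icc_right hτ.2)) hτ.1 (h.1.mono hu hτ) (h.2.1.mono hu hτ)))
  rw [iterInt_congr hV η t ⟨ht, le_rfl⟩,
    iterInt_affineFliess (d := absPair d) hu.abs ht h.1.abs h.2.1.abs]
  have := ((AbsConverges.phiWord (d := absPair d) hu.abs ht h.1.abs h.2.1.abs η).hasSum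
    hu.abs ht).mul_left |c η|
  simpa only [mul_assoc] using this

theorem CascadeConverges.absConverges_mixedComp (h : CascadeConverges c d t₀ t u)
    (hu : IntegrableOn u (Set.Icc t₀ t)) (ht : t₀ ≤ t) :
    AbsConverges (mixedComp c d) t₀ u t := by
  refine summable_of_le_sum_columns (fun η ν => ?_) (h.hasSum_phiWord_absPair hu ht) h.2.2
    (fun ν => mul_nonneg (abs_nonneg _) (iterInt_abs_nonneg hu ht ν))
    (fun ν => wordsBelow (ν.length + 1)) fun ν => ?_
  · exact mul_nonneg (mul_nonneg (abs_nonneg _) ((abs_nonneg _).trans (abs_phiWord_le d η ν)))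
      (iterInt_abs_nonneg hu ht ν)
  · rw [← Finset.sum_mul, mixedComp_eq_sum_wordsBelow c d ν.length.lt_succ_self]
    refine mul_le_mul_of_nonneg_right ((Finset.abs_sum_le_sum_abs _ _).trans
      (Finset.sum_le_sum fun η _ => ?_)) (iterInt_abs_nonneg hu ht ν)
    rw [abs_mul]
    exact mul_le_mul_of_nonneg_left (abs_phiWord_le d η ν) (abs_nonneg _)

/-- Row η sums to (c, η) E_η[F_{d_δ}[u]] by the core identity; column ν sums to the coefficient of
the mixed composition times E_ν[u]. -/
theorem CascadeConverges.fliess_affineFliess (h : CascadeConverges c d t₀ t u)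
    (hu : IntegrableOn u (Set.Icc t₀ t)) (ht : t₀ ≤ t) :
    fliess c t₀ (affineFliess d t₀ u) t = fliess (mixedComp c d) t₀ u t := by
  rw [fliess, fliess]
  refine (tsum_columns_eq_tsum_rows
    (G := fun η ν => c η * Fliess.phiWord d η (wordSeries []) ν * iterInt t₀ u ν t)
    (fun η ν => ?_) (h.hasSum_phiWord_absPair hu ht) h.2.2 (fun η => ?_)
    (fun ν => wordsBelow (ν.length + 1)) (fun ν η hη => ?_) fun ν => ?_).symm
  · rw [abs_mul, abs_mul]
    exact mul_le_mul (mul_le_mul_of_nonneg_left (abs_phiWord_le d η ν) (abs_nonneg _))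
      (abs_iterInt_le hu hu.abs (fun _ _ => le_rfl) ν t ⟨ht, le_rfl⟩) (abs_nonneg _)
      (mul_nonneg (abs_nonneg _) ((abs_nonneg _).trans (abs_phiWord_le d η ν)))
  · rw [iterInt_affineFliess hu ht h.1 h.2.1]
    simpa only [mul_assoc] using
      ((AbsConverges.phiWord hu ht h.1 h.2.1 η).hasSum hu ht).mul_left (c η)
  · rw [mem_wordsBelow] at hη
    rw [phiWord_eq_zero d η ν (by omega), mul_zero, zero_mul]
  · rw [← Finset.sum_mul, mixedComp_eq_sum_wordsBelow c d ν.length.lt_succ_self]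

end

theorem affineFliess_affineFliess {c d : SeriesPair} {u : ℝ → ℝ} {t₀ t : ℝ}
    (h1 : CascadeConverges c.1 d t₀ t u) (h2 : CascadeConverges c.2 d t₀ t u)
    (hu : IntegrableOn u (Set.Icc t₀ t)) (ht : t₀ ≤ t) :
    AbsConverges (pairComp c d).1 t₀ u t ∧ AbsConverges (pairComp c d).2 t₀ u t ∧
      affineFliess c t₀ (affineFliess d t₀ u) t = affineFliess (pairComp c d) t₀ u t := by
  have hm1 := h1.absConverges_mixedComp hu ht
  have hm2 := h2.absConverges_mixedComp hu ht
  have hs1 := hm1.shuffle h1.1 hu ht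
  have hs2 := hm1.shuffle h1.2.1 hu ht
  refine ⟨hs1, hs2.add hm2 hu ht, ?_⟩
  rw [affineFliess, h1.fliess_affineFliess hu ht, h2.fliess_affineFliess hu ht, affineFliess,
    affineFliess, pairComp, fliess_add hs2 hm2 hu ht, fliess_shuffle hm1 h1.1 hu ht,
    fliess_shuffle hm1 h1.2.1 hu ht]
  ring

/-! ### Locally convergent series -/

section

variable {c : Series} {d : SeriesPair} {K M : ℝ}

/-- The words of length n contribute at most K (M a)^n, where a = t - t₀ + ∫|u|. The ratio is at
most 1/2, so the total is at most 2K. -/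
theorem absConverges_of_factorial_bound {u : ℝ → ℝ} {t₀ t : ℝ} (hK : 0 ≤ K) (hM : 0 ≤ M)
    (hc : ∀ η : Word, |c η| ≤ K * M ^ η.length * (Nat.factorial η.length : ℝ))
    (hu : IntegrableOn u (Set.Icc t₀ t)) (ht : t₀ ≤ t)
    (hsmall : M * (t - t₀ + ∫ τ in t₀..t, |u τ|) ≤ 1 / 2) :
    AbsConverges c t₀ u t ∧ fliess (fun η => |c η|) t₀ (fun τ => |u τ|) t ≤ 2 * K := by
  set a := t - t₀ + ∫ τ in t₀..t, |u τ| with ha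
  have ha0 : 0 ≤ a := add_nonneg (sub_nonneg.2 ht)
    (intervalIntegral.integral_nonneg ht fun _ _ => abs_nonneg _)
  have hnn : ∀ η, 0 ≤ |c η| * iterInt t₀ (fun τ => |u τ|) η t := fun η =>
    mul_nonneg (abs_nonneg _) (iterInt_abs_nonneg hu ht η)
  have hlen : ∀ n, ∑ η ∈ wordsOfLength n, |c η| * iterInt t₀ (fun τ => |u τ|) η t ≤
      K * (1 / 2) ^ n := by
    intro n
    calc ∑ η ∈ wordsOfLength n, |c η| * iterInt t₀ (fun τ => |u τ|) η t
        ≤ ∑ η ∈ wordsOfLength n, K * M ^ n * (n.factorial : ℝ) *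
            iterInt t₀ (fun τ => |u τ|) η t := by
          refine Finset.sum_le_sum fun η hη =>
            mul_le_mul_of_nonneg_right ?_ (iterInt_abs_nonneg hu ht η)
          simpa only [mem_wordsOfLength.1 hη] using hc η
      _ = K * (M * a) ^ n := by
          rw [← Finset.mul_sum, mul_assoc, factorial_mul_sum_iterInt hu.abs ⟨ht, le_rfl⟩, mul_pow,
            mul_assoc]
      _ ≤ K * (1 / 2) ^ n :=
          mul_le_mul_of_nonneg_left (pow_le_pow_left₀ (mul_nonneg hM ha0) hsmall n) hK
  have hfin : ∀ s : Finset Word, ∑ η ∈ s, |c η| * iterInt t₀ (fun τ => |u τ|) η t ≤ 2 * K := by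
    intro s
    have hs : s ⊆ wordsBelow (s.sup List.length + 1) := fun η hη =>
      mem_wordsBelow.2 (Nat.lt_succ_of_le (Finset.le_sup (f := List.length) hη))
    refine (Finset.sum_le_sum_of_subset_of_nonneg hs fun η _ _ => hnn η).trans ?_
    rw [sum_wordsBelow]
    refine (Finset.sum_le_sum fun n _ => hlen n).trans ?_
    rw [← Finset.mul_sum, mul_comm]
    refine mul_le_mul_of_nonneg_right ?_ hK
    have := summable_geometric_two.sum_le_tsum (Finset.range (s.sup List.length + 1))
      fun n _ => by positivity
    rwa [tsum_geometric_two] at this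
  exact ⟨summable_of_sum_le hnn hfin, Real.tsum_le_of_sum_le hnn hfin⟩

/-- One δ serves as both radius and duration. Validity for every δ ≤ ε allows two outer series to
share a common δ. -/
theorem LocallyConvergent.exists_cascadeConverges (hc : LocallyConvergent c)
    (h1 : LocallyConvergent d.1) (h2 : LocallyConvergent d.2) :
    ∃ ε : ℝ, 0 < ε ∧ ∀ δ ∈ Set.Ioc 0 ε, ∀ (t₀ : ℝ) (u : ℝ → ℝ), InBall δ t₀ (t₀ + δ) u →
      CascadeConverges c d t₀ (t₀ + δ) u := by
  obtain ⟨K, M, hK, hM, hc⟩ := hc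
  obtain ⟨K₁, M₁, hK₁, hM₁, h1⟩ := h1
  obtain ⟨K₂, M₂, hK₂, hM₂, h2⟩ := h2
  -- M₁ and M₂ control the inner series, where duration plus norm is at most 2δ. The last summand
  -- controls the outer one, since V ≤ 2K₁|u| + 2K₂ makes duration plus ∫V at most (1 + 2K₁ + 2K₂)δ.
  set B := M₁ + M₂ + M * (1 + 2 * K₁ + 2 * K₂) with hB
  have hB0 : 0 < B := by positivity
  refine ⟨1 / (4 * B), by positivity, fun δ hδ t₀ u hu => ?_⟩
  have hδ0 : 0 < δ := hδ.1
  have hBδ : B * δ ≤ 1 / 4 := by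
    have := mul_le_mul_of_nonneg_left hδ.2 hB0.le
    rwa [show B * (1 / (4 * B)) = 1 / 4 by field_simp] at this
  have hBδ' : M₁ * δ + M₂ * δ + M * (1 + 2 * K₁ + 2 * K₂) * δ ≤ 1 / 4 := by
    rw [hB] at hBδ
    linarith
  have hp1 : 0 ≤ M₁ * δ := by positivity
  have hp2 : 0 ≤ M₂ * δ := by positivity
  have hp3 : 0 ≤ M * (1 + 2 * K₁ + 2 * K₂) * δ := by positivity
  have hle : t₀ ≤ t₀ + δ := by linarith
  obtain ⟨hint, hnorm⟩ := hu
  have hnorm' : ∀ t ∈ Set.Icc t₀ (t₀ + δ), ∫ τ in t₀..t, |u τ| ≤ δ := by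
    intro t ht
    refine le_trans ?_ hnorm
    rw [intervalIntegral.integral_of_le ht.1]
    exact setIntegral_mono_set hint.abs (Filter.Eventually.of_forall fun _ => abs_nonneg _)
      (Set.Ioc_subset_Icc_self.trans (Set.Icc_subset_Icc_right ht.2)).eventuallyLE
  have hsub : ∀ t ∈ Set.Icc t₀ (t₀ + δ), IntegrableOn u (Set.Icc t₀ t) := fun t ht =>
    hint.mono_set (Set.Icc_subset_Icc_right ht.2)
  have hsmall : ∀ N, 0 ≤ N → N * δ ≤ 1 / 4 → ∀ t ∈ Set.Icc t₀ (t₀ + δ),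
      N * (t - t₀ + ∫ τ in t₀..t, |u τ|) ≤ 1 / 2 := by
    intro N hN hNδ t ht
    have : t - t₀ + ∫ τ in t₀..t, |u τ| ≤ 2 * δ := by linarith [hnorm' t ht, ht.2]
    linarith [mul_le_mul_of_nonneg_left this hN]
  have hd1 := fun t ht => absConverges_of_factorial_bound hK₁.le hM₁.le h1 (hsub t ht) ht.1
    (hsmall M₁ hM₁.le (by linarith) t ht)
  have hd2 := fun t ht => absConverges_of_factorial_bound hK₂.le hM₂.le h2 (hsub t ht) ht.1
    (hsmall M₂ hM₂.le (by linarith) t ht)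
  have hend : t₀ + δ ∈ Set.Icc t₀ (t₀ + δ) := ⟨hle, le_rfl⟩
  have hc1 := (hd1 _ hend).1
  have hc2 := (hd2 _ hend).1
  have hV := integrableOn_affineFliess (d := absPair d) hint.abs hc1.abs hc2.abs
  refine ⟨hc1, hc2, (absConverges_of_factorial_bound hK.le hM.le hc hV hle ?_).1⟩
  have hVle : ∀ t ∈ Set.Icc t₀ (t₀ + δ), |affineFliess (absPair d) t₀ (fun τ => |u τ|) t| ≤
      2 * K₁ * |u t| + 2 * K₂ := by
    intro t ht
    rw [abs_of_nonneg ((abs_nonneg _).trans (abs_affineFliess_le (hsub t ht) ht.1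
      (hd1 t ht).1 (hd2 t ht).1))]
    refine add_le_add ?_ (hd2 t ht).2
    rw [mul_comm]
    exact mul_le_mul_of_nonneg_right (hd1 t ht).2 (abs_nonneg _)
  have hstart : t₀ ∈ Set.Icc t₀ (t₀ + δ) := ⟨le_rfl, hle⟩
  have hi := (intervalIntegrable_of_integrableOn_Icc hint.abs hstart hend).const_mul (2 * K₁)
  have hVint : ∫ τ in t₀..(t₀ + δ), |affineFliess (absPair d) t₀ (fun τ => |u τ|) τ| ≤
      2 * K₁ * δ + 2 * K₂ * δ := by
    refine (intervalIntegral.integral_mono_on hle (intervalIntegrable_of_integrableOn_Icc hV.abs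
      hstart hend) (hi.add intervalIntegrable_const) hVle).trans ?_
    rw [intervalIntegral.integral_add hi intervalIntegrable_const,
      intervalIntegral.integral_const_mul, intervalIntegral.integral_const, smul_eq_mul]
    have := mul_le_mul_of_nonneg_left (hnorm' _ hend) (show 0 ≤ 2 * K₁ by positivity)
    linarith
  have := mul_le_mul_of_nonneg_left hVint hM.le
  linarith

end

end Fliess

/-! ### The composition identities in the three settings -/

theorem mainTheorem5 :
    -- formal operators, arbitrary series
    ((∀ (c : Fliess.Series) (d : Fliess.SeriesPair),
        Fliess.formalFliess c ∘ Fliess.formalAffineFliess d =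
          Fliess.formalFliess (Fliess.mixedComp c d)) ∧
      (∀ c d : Fliess.SeriesPair,
        Fliess.formalAffineFliess c ∘ Fliess.formalAffineFliess d =
          Fliess.formalAffineFliess (Fliess.pairComp c d))) ∧
    -- integrable inputs, arbitrary series, wherever the cascade converges absolutely
    ((∀ (c : Fliess.Series) (d : Fliess.SeriesPair) (t₀ t₁ : ℝ) (u : ℝ → ℝ), t₀ ≤ t₁ →
        MeasureTheory.IntegrableOn u (Set.Icc t₀ t₁) →
        Fliess.CascadeConverges c d t₀ t₁ u →
        MeasureTheory.IntegrableOn (Fliess.affineFliess d t₀ u) (Set.Icc t₀ t₁) ∧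
        ∀ t ∈ Set.Icc t₀ t₁,
          Fliess.AbsConverges c t₀ (Fliess.affineFliess d t₀ u) t ∧
          Fliess.AbsConverges (Fliess.mixedComp c d) t₀ u t ∧
          Fliess.fliess c t₀ (Fliess.affineFliess d t₀ u) t =
            Fliess.fliess (Fliess.mixedComp c d) t₀ u t) ∧
      (∀ (c d : Fliess.SeriesPair) (t₀ t₁ : ℝ) (u : ℝ → ℝ), t₀ ≤ t₁ →
        MeasureTheory.IntegrableOn u (Set.Icc t₀ t₁) →
        Fliess.CascadeConverges c.1 d t₀ t₁ u → Fliess.CascadeConverges c.2 d t₀ t₁ u →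
        MeasureTheory.IntegrableOn (Fliess.affineFliess d t₀ u) (Set.Icc t₀ t₁) ∧
        ∀ t ∈ Set.Icc t₀ t₁,
          Fliess.AbsConverges c.1 t₀ (Fliess.affineFliess d t₀ u) t ∧
          Fliess.AbsConverges c.2 t₀ (Fliess.affineFliess d t₀ u) t ∧
          Fliess.AbsConverges (Fliess.pairComp c d).1 t₀ u t ∧
          Fliess.AbsConverges (Fliess.pairComp c d).2 t₀ u t ∧
          Fliess.affineFliess c t₀ (Fliess.affineFliess d t₀ u) t =
            Fliess.affineFliess (Fliess.pairComp c d) t₀ u t)) ∧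
    -- locally convergent series, all inputs in a small ball
    ((∀ (c : Fliess.Series) (d : Fliess.SeriesPair), Fliess.LocallyConvergent c →
        Fliess.LocallyConvergent d.1 → Fliess.LocallyConvergent d.2 →
        ∃ R T : ℝ, 0 < R ∧ 0 < T ∧ ∀ (t₀ : ℝ) (u : ℝ → ℝ),
          Fliess.InBall R t₀ (t₀ + T) u →
          Fliess.CascadeConverges c d t₀ (t₀ + T) u ∧
          ∀ t ∈ Set.Icc t₀ (t₀ + T),
            Fliess.fliess c t₀ (Fliess.affineFliess d t₀ u) t =
              Fliess.fliess (Fliess.mixedComp c d) t₀ u t) ∧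
      (∀ c d : Fliess.SeriesPair,
        Fliess.LocallyConvergent c.1 → Fliess.LocallyConvergent c.2 →
        Fliess.LocallyConvergent d.1 → Fliess.LocallyConvergent d.2 →
        ∃ R T : ℝ, 0 < R ∧ 0 < T ∧ ∀ (t₀ : ℝ) (u : ℝ → ℝ),
          Fliess.InBall R t₀ (t₀ + T) u →
          Fliess.CascadeConverges c.1 d t₀ (t₀ + T) u ∧
          Fliess.CascadeConverges c.2 d t₀ (t₀ + T) u ∧
          ∀ t ∈ Set.Icc t₀ (t₀ + T),
            Fliess.affineFliess c t₀ (Fliess.affineFliess d t₀ u) t =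
              Fliess.affineFliess (Fliess.pairComp c d) t₀ u t)) := by
  refine ⟨⟨Fliess.formalFliess_comp_formalAffineFliess,
    Fliess.formalAffineFliess_comp_formalAffineFliess⟩,
    ⟨fun c d t₀ t₁ u _ hu h => ⟨Fliess.integrableOn_affineFliess hu h.1 h.2.1, fun t ht => ?_⟩,
      fun c d t₀ t₁ u _ hu h h' => ⟨Fliess.integrableOn_affineFliess hu h.1 h.2.1,
        fun t ht => ?_⟩⟩,
    fun c d hc h1 h2 => ?_, fun c d hc hc' h1 h2 => ?_⟩
  · have hut := hu.mono_set (Set.Icc_subset_Icc_right ht.2)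
    have h := h.mono hu ht
    exact ⟨h.absConverges_affineFliess hut ht.1, h.absConverges_mixedComp hut ht.1,
      h.fliess_affineFliess hut ht.1⟩
  · have hut := hu.mono_set (Set.Icc_subset_Icc_right ht.2)
    have h := h.mono hu ht
    have h' := h'.mono hu ht
    exact ⟨h.absConverges_affineFliess hut ht.1, h'.absConverges_affineFliess hut ht.1,
      Fliess.affineFliess_affineFliess h h' hut ht.1⟩
  · obtain ⟨ε, hε, H⟩ := hc.exists_cascadeConverges h1 h2
    refine ⟨ε, ε, hε, hε, fun t₀ u hu => ?_⟩
    have h := H ε ⟨hε, le_rfl⟩ t₀ u hu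
    exact ⟨h, fun t ht => (h.mono hu.1 ht).fliess_affineFliess
      (hu.1.mono_set (Set.Icc_subset_Icc_right ht.2)) ht.1⟩
  · obtain ⟨ε, hε, H⟩ := hc.exists_cascadeConverges h1 h2
    obtain ⟨ε', hε', H'⟩ := hc'.exists_cascadeConverges h1 h2
    have hpos : 0 < min ε ε' := lt_min hε hε'
    refine ⟨min ε ε', min ε ε', hpos, hpos, fun t₀ u hu => ?_⟩
    have h := H _ ⟨hpos, min_le_left _ _⟩ t₀ u hu
    have h' := H' _ ⟨hpos, min_le_right _ _⟩ t₀ u hu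
    exact ⟨h, h', fun t ht => (Fliess.affineFliess_affineFliess (h.mono hu.1 ht)
      (h'.mono hu.1 ht) (hu.1.mono_set (Set.Icc_subset_Icc_right ht.2)) ht.1).2.2⟩
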